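/- Let $Z$ be a standard normal random variable and let $\lambda:=\ln\frac{2e^3}{9}=1.495\ldots$. All random variables below are defined on a probability space with probability measure $\mathsf P$. (1) Let $\eta_1,\eta_2,\dots$ be independent (not necessarily identically distributed) zero-mean real random variables with $|\eta_i|\le 1$ almost surely for all $i$, and let $\mathbf x_1,\mathbf x_2,\dots$ be non-random vectors in a real or complex Hilbert space $(H,\|\cdot\|)$ with $\sum_i\|\mathbf x_i\|^2=1$. Then the partial sums of $\eta_1\mathbf x_1+\eta_2\mathbf x_2+\cdots$ converge in $H$ almost surely, and $$\mathsf P\bigl(\|\eta_1\mathbf x_1+\eta_2\mathbf x_2+\cdots\|\ge x\bigr)\le\min\Bigl(\frac1{x^2},\ \mathsf P\bigl(|Z|\ge x-\tfrac{\lambda}{x}\bigr)\Bigr)\qquad\text{for all }x>0.$$ (2) Let $(S_n)_{n\ge0}$ be a real-valued martingale (with respect to some filtration) with $S_0=0$ almost surely and differences $X_i:=S_i-S_{i-1}$, $i\ge1$, such that $\sum_{i\ge1}\operatorname{ess\,sup}|X_i|^2\le1$. Then for all $n\ge0$ and all $x>0$, $$\mathsf P(S_n\ge x)\le\min\Bigl(e^{-x^2/2},\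 \mathsf P\bigl(Z\ge x-\tfrac{\lambda}{x}\bigr)\Bigr)\quad\text{and}\quad \mathsf P(|S_n|\ge x)\le\min\Bigl(\frac1{x^2},\ \mathsf P\bigl(|Z|\ge x-\tfrac{\lambda}{x}\bigr)\Bigr).$$ -/

import Mathlib

open MeasureTheory ProbabilityTheory Filter Topology
open scoped ENNReal

noncomputable section

namespace BoundedSums

/-- The constant `ln (2 e ^ 3 / 9) = 1.495...`. -/
def lam : ℝ := Real.log (2 * Real.exp 3 / 9)

/-- `P(Z ≥ t)` for a standard normal random variable `Z`. -/
def normalTail (t : ℝ) : ℝ := (gaussianReal 0 1).real {z : ℝ | t ≤ z}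

/-- `P(|Z| ≥ t)` for a standard normal random variable `Z`. -/
def normalTwoTail (t : ℝ) : ℝ := (gaussianReal 0 1).real {z : ℝ | t ≤ |z|}

/-- The one-sided bound `W(x) = min (e^{-x²/2}, P(Z ≥ x - λ/x))`, used for `x > 0`. -/
def oneSidedBound (x : ℝ) : ℝ := min (Real.exp (-x ^ 2 / 2)) (normalTail (x - lam / x))

/-- The two-sided bound `min (1/x², P(|Z| ≥ x - λ/x))`, used for `x > 0`. -/
def twoSidedBound (x : ℝ) : ℝ := min (1 / x ^ 2) (normalTwoTail (x - lam / x))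

end BoundedSums

end

/-! The proof compares third moments with a Gaussian. For f(y) = (y - t)₊³, the sum s ↦ f(p + √s) +
f(p - √s) is convex on s ≥ 0 (`convexOn_cubePos_sqrt`). Jensen applied to s = z² then shows that
replacing a step ±c by a centred Gaussian step of variance c² can only increase the expectation of
f. A centred increment bounded by 1 times a fixed vector is dominated, on convex functions, by the
symmetric two-point step (`integral_convex_step_le`). Replacing steps one by one gives E(S - t)₊³ ≤
E(Z - t)₊³. For vectors, f is replaced by an even function of the norm; the parallelogram law and
the same convexity in the squared norm reduce a two-point step to the collinear case
(`radialCube_two_point_le`), at the price of a factor 2.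

Markov's inequality gives P(S ≥ x) ≤ E(Z - t)₊³ / (x - t)³. Log-concavity of the normal tail bounds
it by an exponential with rate the hazard rate h at x; with t = x - 3/h the right side is at most
(2e³/9) P(Z ≥ x) = e^λ P(Z ≥ x) (`exists_gaussCube_le`). For x ≥ √λ this is at most P(Z ≥ x - λ/x)
(`exp_lam_mul_normalTail_le`). For x ≤ √λ the two-sided Gaussian bound is 1, and the one-sided bound
follows from Cantelli's inequality (`inv_one_add_sq_le_normalTail`).

The bounds 1/x² and exp(-x²/2) come from second moments and from cosh u ≤ exp(u²/2). Infinite sums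
converge by Kolmogorov's maximal inequality, and inherit the tail bounds by continuity in x. -/

namespace BoundedSums

open scoped NNReal

/-! ### Cubes of positive parts and Gaussian smoothing -/

/-- The cube of the positive part. -/
def cubePos (y : ℝ) : ℝ := max y 0 ^ 3

lemma cubePos_nonneg (y : ℝ) : 0 ≤ cubePos y := by unfold cubePos; positivity

lemma continuous_cubePos : Continuous cubePos := by unfold cubePos; fun_prop

lemma cubePos_le_abs (y : ℝ) : cubePos y ≤ |y| ^ 3 := by
  unfold cubePos
  gcongr
  exact max_le (le_abs_self y) (abs_nonneg y)

lemma convexOn_cubePos : ConvexOn ℝ Set.univ cubePos := by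
  have h : ConvexOn ℝ Set.univ (fun y : ℝ => max y 0) :=
    (convexOn_id convex_univ).sup (convexOn_const 0 convex_univ)
  exact h.pow (fun y _ => le_max_right _ _) 3

lemma hasDerivAt_cubePos (y : ℝ) : HasDerivAt cubePos (3 * max y 0 ^ 2) y := by
  have key : ∀ z : ℝ, z ≠ 0 → HasDerivAt cubePos (3 * max z 0 ^ 2) z := by
    intro z hz
    rcases lt_or_gt_of_ne hz with h | h
    · have h1 : cubePos =ᶠ[𝓝 z] fun _ => (0 : ℝ) := by
        filter_upwards [eventually_lt_nhds h] with w hw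
        simp [cubePos, max_eq_right hw.le]
      have := (hasDerivAt_const z (0 : ℝ)).congr_of_eventuallyEq h1
      simpa [max_eq_right h.le] using this
    · have h1 : cubePos =ᶠ[𝓝 z] fun w => w ^ 3 := by
        filter_upwards [eventually_gt_nhds h] with w hw
        simp [cubePos, max_eq_left hw.le]
      have := (hasDerivAt_pow 3 z).congr_of_eventuallyEq h1
      simpa [max_eq_left h.le] using this
  by_cases hy : y = 0
  · subst hy
    exact hasDerivAt_of_hasDerivAt_of_ne key continuous_cubePos.continuousAt
      (by fun_prop)
  · exact key y hy

/-- As a function of r ≥ 0 the numerator is convex and vanishes at 0, so its slope from the origin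
increases. The proof checks the sign patterns of p ± r and p ± r'. -/
lemma sq_posPart_sub_div_mono (p : ℝ) {r r' : ℝ} (hr : 0 < r) (h : r ≤ r') :
    (max (p + r) 0 ^ 2 - max (p - r) 0 ^ 2) / r ≤
      (max (p + r') 0 ^ 2 - max (p - r') 0 ^ 2) / r' := by
  have hr' : 0 < r' := hr.trans_le h
  rw [div_le_div_iff₀ hr hr']
  have e1 : 0 ≤ r' - r := sub_nonneg.2 h
  rcases le_total 0 (p - r) with h1 | h1 <;> rcases le_total 0 (p - r') with h2 | h2 <;>
    rcases le_total 0 (p + r) with h3 | h3 <;> rcases le_total 0 (p + r') with h4 | h4 <;>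
    simp only [max_eq_left h1, max_eq_left h2, max_eq_left h3, max_eq_left h4, max_eq_right h1,
      max_eq_right h2, max_eq_right h3, max_eq_right h4] <;>
    first
    | (exfalso; linarith)
    | nlinarith [mul_nonneg hr.le (sq_nonneg (p - r'))]
    | nlinarith [mul_nonneg e1 (by nlinarith : 0 ≤ r * r' - p ^ 2)]
    | (rw [show p + r = 0 by linarith]; simp)

/-- The derivative in s is a multiple of the quotient in `sq_posPart_sub_div_mono` at r = √s, hence
increasing. All Gaussian comparisons rest on this convexity. -/
lemma convexOn_cubePos_sqrt (p : ℝ) :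
    ConvexOn ℝ (Set.Ici 0) (fun s => cubePos (p + √s) + cubePos (p - √s)) := by
  have hd : ∀ s ∈ Set.Ioi (0 : ℝ), HasDerivAt (fun s => cubePos (p + √s) + cubePos (p - √s))
      (3 / 2 * ((max (p + √s) 0 ^ 2 - max (p - √s) 0 ^ 2) / √s)) s := by
    intro s hs
    have h0 := Real.hasDerivAt_sqrt (ne_of_gt hs)
    have h1 := (hasDerivAt_cubePos (p + √s)).comp s (h0.const_add p)
    have h2 := (hasDerivAt_cubePos (p - √s)).comp s (h0.const_sub p)
    refine (h1.add h2).congr_deriv ?_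
    have : √s ≠ 0 := (Real.sqrt_pos.2 hs).ne'
    field_simp
    ring
  refine MonotoneOn.convexOn_of_deriv (convex_Ici 0) ?_ ?_ ?_
  · have := continuous_cubePos
    fun_prop
  · rw [interior_Ici]
    exact fun s hs => (hd s hs).differentiableAt.differentiableWithinAt
  · rw [interior_Ici]
    intro s hs s' hs' hss
    rw [(hd s hs).deriv, (hd s' hs').deriv]
    have := sq_posPart_sub_div_mono p (Real.sqrt_pos.2 hs) (Real.sqrt_le_sqrt hss)
    linarith

/-- Gaussian smoothing of the cube of the positive part. -/
noncomputable def gaussCube (R : ℝ≥0) (y : ℝ) : ℝ := ∫ z, cubePos (y + z) ∂(gaussianReal 0 R)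

lemma integrable_cubePos (m : ℝ) (R : ℝ≥0) (y : ℝ) :
    Integrable (fun z => cubePos (y + z)) (gaussianReal m R) := by
  have h : MemLp (fun z : ℝ => y + z) ((3 : ℕ) : ℝ≥0∞) (gaussianReal m R) := by
    exact (memLp_const y).add (memLp_id_gaussianReal 3)
  refine (h.integrable_norm_pow (by norm_num)).mono'
    (continuous_cubePos.comp (by fun_prop)).aestronglyMeasurable (ae_of_all _ fun z => ?_)
  rw [Real.norm_eq_abs, abs_of_nonneg (cubePos_nonneg _)]
  exact cubePos_le_abs _

lemma integrable_cubePos_sub (R : ℝ≥0) (y : ℝ) :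
    Integrable (fun z => cubePos (y - z)) (gaussianReal 0 R) := by
  have h : Integrable (fun z => cubePos (y + z)) ((gaussianReal 0 R).map (fun x => -x)) := by
    rw [gaussianReal_map_neg]; exact integrable_cubePos _ _ _
  have := h.comp_measurable (measurable_neg)
  simpa [Function.comp_def, sub_eq_add_neg] using this

lemma gaussCube_eq_sub (R : ℝ≥0) (y : ℝ) :
    gaussCube R y = ∫ z, cubePos (y - z) ∂(gaussianReal 0 R) := by
  have h : gaussianReal 0 R = (gaussianReal 0 R).map (fun x => -x) := by
    rw [gaussianReal_map_neg, neg_zero]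
  unfold gaussCube
  conv_lhs => rw [h]
  have hc : Continuous fun z => cubePos (y + z) := continuous_cubePos.comp (by fun_prop)
  rw [integral_map (φ := fun x : ℝ => -x) measurable_neg.aemeasurable hc.aestronglyMeasurable]
  simp [sub_eq_add_neg]

lemma convexOn_integral {F : Type*} [AddCommMonoid F] [Module ℝ F] {α : Type*}
    [MeasurableSpace α] {μ : Measure α} {s : Set F} {f : F → α → ℝ} (hs : Convex ℝ s)
    (hf : ∀ z, ConvexOn ℝ s fun y => f y z) (hi : ∀ y, Integrable (f y) μ) :
    ConvexOn ℝ s fun y => ∫ z, f y z ∂μ := by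
  refine ⟨hs, fun x hx y hy a b ha hb hab => ?_⟩
  have e : a • ∫ z, f x z ∂μ + b • ∫ z, f y z ∂μ = ∫ z, (a * f x z + b * f y z) ∂μ := by
    rw [integral_add ((hi x).const_mul a) ((hi y).const_mul b), integral_const_mul,
      integral_const_mul, smul_eq_mul, smul_eq_mul]
  simp only [e]
  exact integral_mono (hi _) (((hi x).const_mul a).add ((hi y).const_mul b))
    fun z => (hf z).2 hx hy ha hb hab

lemma convexOn_gaussCube (R : ℝ≥0) : ConvexOn ℝ Set.univ (gaussCube R) := by
  refine convexOn_integral convex_univ (fun z => ?_) (fun y => integrable_cubePos _ _ _)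
  exact convexOn_cubePos.translate_left z

lemma continuous_gaussCube (R : ℝ≥0) : Continuous (gaussCube R) :=
  continuousOn_univ.1 ((convexOn_gaussCube R).continuousOn isOpen_univ)

lemma gaussCube_nonneg (R : ℝ≥0) (y : ℝ) : 0 ≤ gaussCube R y :=
  integral_nonneg fun _ => cubePos_nonneg _

lemma integral_sq_gaussianReal (R : ℝ≥0) : ∫ z, z ^ 2 ∂(gaussianReal 0 R) = R := by
  have h := variance_id_gaussianReal (μ := 0) (v := R)
  rw [variance_eq_integral (by fun_prop)] at h
  simpa using h

lemma cubePos_le_gaussCube (R : ℝ≥0) (y : ℝ) : cubePos y ≤ gaussCube R y := by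
  have h1 : Integrable (fun z : ℝ => y + z) (gaussianReal 0 R) := by
    exact (integrable_const y).add (memLp_one_iff_integrable.1 (memLp_id_gaussianReal 1))
  have := convexOn_cubePos.map_integral_le (μ := gaussianReal 0 R) (f := fun z => y + z)
    continuous_cubePos.continuousOn isClosed_univ (by simp) h1 (integrable_cubePos _ _ _)
  have h2 : ∫ z, (y + z) ∂(gaussianReal 0 R) = y := by
    have h3 : Integrable (fun z : ℝ => z) (gaussianReal 0 R) :=
      memLp_one_iff_integrable.1 (memLp_id_gaussianReal 1)
    rw [integral_add (integrable_const y) h3]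
    simp [integral_id_gaussianReal]
  rwa [h2] at this

lemma cubePos_two_point_le {R : ℝ≥0} {c : ℝ} (e : (R : ℝ) = c ^ 2) (p : ℝ) :
    cubePos (p + c) + cubePos (p - c) ≤ 2 * gaussCube R p := by
  -- The function is even in the root, so the sign lost in √(z²) = |z| does not matter.
  have abs_form : ∀ z : ℝ, cubePos (p + √(z ^ 2)) + cubePos (p - √(z ^ 2)) =
      cubePos (p + z) + cubePos (p - z) := by
    intro z
    rw [Real.sqrt_sq_eq_abs]
    rcases abs_cases z with ⟨h, _⟩ | ⟨h, _⟩ <;> rw [h]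
    ring_nf
  have hi : Integrable (fun z => cubePos (p + z) + cubePos (p - z)) (gaussianReal 0 R) :=
    (integrable_cubePos _ _ _).add (integrable_cubePos_sub _ _)
  have hsq : Integrable (fun z : ℝ => z ^ 2) (gaussianReal 0 R) := by
    have h2 : MemLp id ((2 : ℕ) : ℝ≥0∞) (gaussianReal 0 R) := memLp_id_gaussianReal 2
    simpa using h2.integrable_norm_pow (by norm_num)
  have hc : Continuous (fun s => cubePos (p + √s) + cubePos (p - √s)) := by
    have := continuous_cubePos
    fun_prop
  -- Jensen for the variable z², whose mean is the variance R = c².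
  have := (convexOn_cubePos_sqrt p).map_integral_le (μ := gaussianReal 0 R)
    (f := fun z => z ^ 2) hc.continuousOn isClosed_Ici
    (ae_of_all _ fun z => sq_nonneg z) hsq (by simpa only [Function.comp_def, abs_form] using hi)
  rw [integral_sq_gaussianReal] at this
  simp only [abs_form] at this
  rw [integral_add (integrable_cubePos _ _ _) (integrable_cubePos_sub _ _),
    ← gaussCube_eq_sub] at this
  rw [e, abs_form] at this
  unfold gaussCube at *
  linarith

lemma integrable_gaussCube (R R' : ℝ≥0) (y : ℝ) :
    Integrable (fun z => gaussCube R' (y + z)) (gaussianReal 0 R) := by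
  have h : Integrable (fun z => cubePos (y + z)) (gaussianReal 0 R ∗ gaussianReal 0 R') := by
    rw [gaussianReal_conv_gaussianReal]; exact integrable_cubePos _ _ _
  have h2 := ((integrable_map_measure (by
    exact (continuous_cubePos.comp (by fun_prop)).aestronglyMeasurable)
    (by fun_prop)).1 h).integral_prod_left
  simpa [gaussCube, add_assoc, Function.comp_def] using h2

lemma gaussCube_add (R R' : ℝ≥0) (y : ℝ) :
    gaussCube (R + R') y = ∫ z, gaussCube R' (y + z) ∂(gaussianReal 0 R) := by
  have h : Integrable (fun z => cubePos (y + z)) (gaussianReal 0 R ∗ gaussianReal 0 R') := by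
    rw [gaussianReal_conv_gaussianReal]; exact integrable_cubePos _ _ _
  have h2 := integral_conv h
  rw [gaussianReal_conv_gaussianReal, add_zero] at h2
  unfold gaussCube
  rw [h2]
  simp only [add_assoc]

lemma gaussCube_two_point_le (R : ℝ≥0) {R' : ℝ≥0} {c : ℝ} (e : (R' : ℝ) = c ^ 2) (p : ℝ) :
    gaussCube R (p + c) + gaussCube R (p - c) ≤ 2 * gaussCube (R + R') p := by
  rw [gaussCube_add, ← integral_const_mul]
  unfold gaussCube
  rw [← integral_add (integrable_cubePos _ _ _) (integrable_cubePos _ _ _)]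
  refine integral_mono ((integrable_cubePos _ _ _).add (integrable_cubePos _ _ _))
    ((integrable_gaussCube _ _ _).const_mul 2) fun z => ?_
  have := cubePos_two_point_le e (p + z)
  rw [add_right_comm, add_sub_right_comm] at this
  exact this

lemma convexOn_gaussCube_sqrt (R : ℝ≥0) (p : ℝ) :
    ConvexOn ℝ (Set.Ici 0) (fun s => gaussCube R (p + √s) + gaussCube R (p - √s)) := by
  have h := convexOn_integral (μ := gaussianReal 0 R)
    (f := fun s z => cubePos (p + √s + z) + cubePos (p - √s + z)) (convex_Ici (0 : ℝ))
    (fun z => by simpa only [add_right_comm, add_sub_right_comm] using convexOn_cubePos_sqrt (p + z))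
    (fun s => (integrable_cubePos _ _ _).add (integrable_cubePos _ _ _))
  refine h.congr fun s _ => ?_
  exact integral_add (integrable_cubePos _ _ _) (integrable_cubePos _ _ _)

/-! ### Radial functions and the parallelogram law -/

lemma ConvexOn.add_le_add_of_mem_Icc {J : ℝ → ℝ} (hJ : ConvexOn ℝ (Set.Ici 0) J)
    {u₁ u₂ w₁ w₂ : ℝ} (hw : 0 ≤ w₂) (hs : u₁ + u₂ = w₁ + w₂) (h2 : w₂ ≤ u₁) (h1 : u₁ ≤ w₁) :
    J u₁ + J u₂ ≤ J w₁ + J w₂ := by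
  rcases (h2.trans h1).eq_or_lt with h | h
  · have e1 : u₁ = w₁ := by linarith
    have e2 : u₂ = w₂ := by linarith
    rw [e1, e2]
  have hd : 0 < w₁ - w₂ := by linarith
  set θ := (u₁ - w₂) / (w₁ - w₂)
  have hθ : θ * (w₁ - w₂) = u₁ - w₂ := div_mul_cancel₀ _ hd.ne'
  have h0 : 0 ≤ θ := div_nonneg (by linarith) hd.le
  have h01 : 0 ≤ 1 - θ := by
    have : θ ≤ 1 := (div_le_one hd).2 (by linarith)
    linarith
  have i1 := hJ.2 (Set.mem_Ici.2 (hw.trans h.le)) (Set.mem_Ici.2 hw) h0 h01 (by ring)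
  have i2 := hJ.2 (Set.mem_Ici.2 (hw.trans h.le)) (Set.mem_Ici.2 hw) h01 h0 (by ring)
  simp only [smul_eq_mul] at i1 i2
  have e1 : θ * w₁ + (1 - θ) * w₂ = u₁ := by linarith
  have e2 : (1 - θ) * w₁ + θ * w₂ = u₂ := by linarith
  rw [e1] at i1
  rw [e2] at i2
  linarith

/-- The radial function `a ↦ W(q + ‖a‖) + W(q - ‖a‖)`, with `W` the Gaussian smoothing of the cube of
the positive part. -/
noncomputable def radialCube {E : Type*} [NormedAddCommGroup E] (q : ℝ) (R : ℝ≥0) (a : E) : ℝ :=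
  gaussCube R (q + ‖a‖) + gaussCube R (q - ‖a‖)

/-- By the parallelogram law, ‖a ± x‖² have the same sum as (‖a‖ ± ‖x‖)² and lie between them.
Convexity in the squared norm therefore makes the collinear case extremal, and there the
one-dimensional inequality applies at q + ‖a‖ and q - ‖a‖. -/
lemma radialCube_two_point_le {E : Type*} [NormedAddCommGroup E] [InnerProductSpace ℝ E]
    (q : ℝ) (R : ℝ≥0) {R' : ℝ≥0} {x : E}
    (hx : (R' : ℝ) = ‖x‖ ^ 2) (a : E) :
    radialCube q R (a + x) + radialCube q R (a - x) ≤ 2 * radialCube q (R + R') a := by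
  have hJ := convexOn_gaussCube_sqrt R q
  set α := ‖a‖
  set β := ‖x‖
  have hp := parallelogram_law_with_norm ℝ a x
  have ha : 0 ≤ α := norm_nonneg a
  have hb : 0 ≤ β := norm_nonneg x
  have n1 : ‖a + x‖ ≤ α + β := norm_add_le a x
  have n2 : |α - β| ≤ ‖a + x‖ := by
    have := abs_norm_sub_norm_le a (-x)
    simpa using this
  have h := ConvexOn.add_le_add_of_mem_Icc hJ (u₁ := ‖a + x‖ ^ 2) (u₂ := ‖a - x‖ ^ 2)
    (w₁ := (α + β) ^ 2) (w₂ := (α - β) ^ 2) (sq_nonneg _) (by simp only [α, β]; nlinarith)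
    (by rw [← sq_abs (α - β)]; gcongr) (by gcongr)
  simp only [Real.sqrt_sq (norm_nonneg _), Real.sqrt_sq (add_nonneg ha hb),
    Real.sqrt_sq_eq_abs (α - β)] at h
  have e : gaussCube R (q + |α - β|) + gaussCube R (q - |α - β|) =
      gaussCube R (q + α - β) + gaussCube R (q - α + β) := by
    rcases abs_cases (α - β) with ⟨h, _⟩ | ⟨h, _⟩ <;> rw [h] <;> ring_nf
  have i1 := gaussCube_two_point_le R hx (q + α)
  have i2 := gaussCube_two_point_le R hx (q - α)
  have e2 : q - (α + β) = q - α - β := by ring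
  have e3 : q + (α + β) = q + α + β := by ring
  rw [e, e2, e3] at h
  unfold radialCube
  linarith

lemma continuous_radialCube {E : Type*} [NormedAddCommGroup E] (q : ℝ) (R : ℝ≥0) :
    Continuous (radialCube (E := E) q R) := by
  have := continuous_gaussCube R
  unfold radialCube
  fun_prop

lemma ConvexOn.comp_norm_of_even {E : Type*} [NormedAddCommGroup E] [NormedSpace ℝ E]
    {f : ℝ → ℝ} (hf : ConvexOn ℝ Set.univ f)
    (he : ∀ y, f (-y) = f y) : ConvexOn ℝ Set.univ (fun a : E => f ‖a‖) := by
  have mono : ∀ y z : ℝ, 0 ≤ y → y ≤ z → f y ≤ f z := by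
    intro y z hy hyz
    have := hf.le_max_of_mem_Icc (x := -z) (y := z) (z := y) (Set.mem_univ _) (Set.mem_univ _)
      ⟨by linarith, hyz⟩
    simpa [he] using this
  refine ⟨convex_univ, fun x _ y _ a b ha hb hab => ?_⟩
  refine (mono _ _ (norm_nonneg _) (?_ : _ ≤ a * ‖x‖ + b * ‖y‖)).trans
    (hf.2 (Set.mem_univ _) (Set.mem_univ _) ha hb hab)
  refine (norm_add_le _ _).trans ?_
  rw [norm_smul, norm_smul, Real.norm_of_nonneg ha, Real.norm_of_nonneg hb]

lemma convexOn_radialCube {E : Type*} [NormedAddCommGroup E] [NormedSpace ℝ E]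
    (q : ℝ) (R : ℝ≥0) :
    ConvexOn ℝ Set.univ (radialCube (E := E) q R) := by
  refine ConvexOn.comp_norm_of_even (f := fun y => gaussCube R (q + y) + gaussCube R (q - y))
    ?_ ?_
  · have h := convexOn_gaussCube R
    refine ⟨convex_univ, fun x _ y _ a b ha hb hab => ?_⟩
    have i1 := h.2 (Set.mem_univ (q + x)) (Set.mem_univ (q + y)) ha hb hab
    have i2 := h.2 (Set.mem_univ (q - x)) (Set.mem_univ (q - y)) ha hb hab
    simp only [smul_eq_mul] at i1 i2 ⊢
    have e1 : a * (q + x) + b * (q + y) = q + (a * x + b * y) := by linear_combination q * hab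
    have e2 : a * (q - x) + b * (q - y) = q - (a * x + b * y) := by linear_combination q * hab
    rw [e1] at i1
    rw [e2] at i2
    linarith
  · intro y
    simp only [sub_neg_eq_add, ← sub_eq_add_neg]
    ring

/-! ### The normal tail and its hazard rate -/

/-- The standard normal density. -/
noncomputable def normalDensity (x : ℝ) : ℝ := gaussianPDFReal 0 1 x

lemma normalDensity_eq (x : ℝ) :
    normalDensity x = (√(2 * Real.pi))⁻¹ * Real.exp (-x ^ 2 / 2) := by
  simp [normalDensity, gaussianPDFReal]

lemma normalDensity_pos (x : ℝ) : 0 < normalDensity x := gaussianPDFReal_pos _ _ _ one_ne_zero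

lemma continuous_normalDensity : Continuous normalDensity := by
  have : normalDensity = fun x => (√(2 * Real.pi))⁻¹ * Real.exp (-x ^ 2 / 2) :=
    funext normalDensity_eq
  rw [this]
  fun_prop

lemma integrable_normalDensity : Integrable normalDensity := integrable_gaussianPDFReal 0 1

lemma normalTail_eq_real_Ici (t : ℝ) : normalTail t = (gaussianReal 0 1).real (Set.Ici t) := rfl

lemma normalTail_eq_real_Ioi (t : ℝ) : normalTail t = (gaussianReal 0 1).real (Set.Ioi t) := by
  have := nullSingletonClass_gaussianReal (μ := 0) (v := 1) one_ne_zero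
  exact measureReal_congr Ioi_ae_eq_Ici.symm

lemma normalTail_eq_integral (t : ℝ) : normalTail t = ∫ x in Set.Ioi t, normalDensity x := by
  rw [normalTail_eq_real_Ioi, measureReal_def, gaussianReal_apply_eq_integral _ one_ne_zero]
  exact ENNReal.toReal_ofReal (integral_nonneg fun x => (normalDensity_pos x).le)

lemma normalTail_sub (a b : ℝ) : normalTail a - normalTail b = ∫ x in a..b, normalDensity x := by
  rw [normalTail_eq_integral, normalTail_eq_integral,
    intervalIntegral.integral_Ioi_sub_Ioi' integrable_normalDensity.integrableOn
      integrable_normalDensity.integrableOn]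

lemma hasDerivAt_normalTail (x : ℝ) : HasDerivAt normalTail (-normalDensity x) x := by
  have h : normalTail = fun u => normalTail 0 - ∫ x in (0 : ℝ)..u, normalDensity x := by
    funext u
    rw [← normalTail_sub]; ring
  rw [h]
  have h1 := intervalIntegral.integral_hasDerivAt_right
    (continuous_normalDensity.intervalIntegrable 0 x)
    (continuous_normalDensity.stronglyMeasurableAtFilter _ _) continuous_normalDensity.continuousAt
  simpa using h1.const_sub (normalTail 0)

lemma continuous_normalTail : Continuous normalTail :=
  continuous_iff_continuousAt.2 fun x => (hasDerivAt_normalTail x).continuousAt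

lemma normalTail_nonneg (x : ℝ) : 0 ≤ normalTail x := measureReal_nonneg

lemma normalTail_antitone : Antitone normalTail := fun _ _ h =>
  measureReal_mono fun _ hz => h.trans hz

lemma normalTail_strictAnti : StrictAnti normalTail :=
  strictAnti_of_hasDerivAt_neg hasDerivAt_normalTail fun x => neg_lt_zero.2 (normalDensity_pos x)

lemma normalTail_pos (x : ℝ) : 0 < normalTail x :=
  (normalTail_nonneg (x + 1)).trans_lt (normalTail_strictAnti (lt_add_one x))

lemma normalTail_neg (x : ℝ) : normalTail (-x) = 1 - normalTail x := by
  have h1 : normalTail (-x) = (gaussianReal 0 1).real (Set.Iic x) := by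
    have h : gaussianReal 0 1 = (gaussianReal 0 1).map (fun x => -x) := by
      rw [gaussianReal_map_neg, neg_zero]
    rw [normalTail_eq_real_Ici, h, map_measureReal_apply (f := fun x : ℝ => -x) measurable_neg
      measurableSet_Ici, ← h]
    congr 1
    ext z
    simp
  rw [h1, normalTail_eq_real_Ioi, ← Set.compl_Iic, measureReal_compl measurableSet_Iic]
  simp

lemma normalTail_zero : normalTail 0 = 1 / 2 := by
  have := normalTail_neg 0
  rw [neg_zero] at this
  linarith

lemma tendsto_normalTail_atTop : Tendsto normalTail atTop (𝓝 0) := by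
  have h : normalTail = fun x => 1 - normalTail (-x) := by
    funext x; rw [normalTail_neg]; ring
  have h2 : ∀ x, normalTail (-x) = cdf (gaussianReal 0 1) x := by
    intro x
    rw [normalTail_neg, cdf_eq_real]
    rw [normalTail_eq_real_Ioi, ← Set.compl_Iic, measureReal_compl measurableSet_Iic]
    simp
  rw [h]
  simp only [h2]
  simpa using (tendsto_cdf_atTop (gaussianReal 0 1)).const_sub 1

lemma normalTwoTail_eq {t : ℝ} (ht : 0 ≤ t) : normalTwoTail t = 2 * normalTail t := by
  have hd : {z : ℝ | t ≤ |z|} =ᵐ[gaussianReal 0 1]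
      (Set.Ici t ∪ Set.Iio (-t) : Set ℝ) := by
    have := nullSingletonClass_gaussianReal (μ := 0) (v := 1) one_ne_zero
    have hne : ∀ᵐ z ∂(gaussianReal 0 1), z ≠ -t := by
      rw [ae_iff]; simp
    filter_upwards [hne] with z hz
    refine propext (?_ : t ≤ |z| ↔ t ≤ z ∨ z < -t)
    rw [le_abs, le_neg]
    exact or_congr Iff.rfl ⟨fun h => lt_of_le_of_ne h hz, le_of_lt⟩
  have h3 : (gaussianReal 0 1).real (Set.Iio (-t)) = 1 - normalTail (-t) := by
    rw [normalTail_eq_real_Ici, ← Set.compl_Ici, measureReal_compl measurableSet_Ici]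
    simp
  have hdisj : Disjoint (Set.Ici t) (Set.Iio (-t)) :=
    Set.disjoint_left.2 fun z (h1 : t ≤ z) (h2 : z < -t) => by linarith
  rw [normalTwoTail, measureReal_congr hd, measureReal_union hdisj measurableSet_Iio, h3,
    normalTail_neg, ← normalTail_eq_real_Ici]
  ring

lemma normalTwoTail_of_nonpos {t : ℝ} (ht : t ≤ 0) : normalTwoTail t = 1 := by
  have : {z : ℝ | t ≤ |z|} = Set.univ := by
    ext z; simpa using ht.trans (abs_nonneg z)
  simp [normalTwoTail, this]

/-- Shift the integral to the half-line from 0: the density at x + y is at most exp(-y²/2) times the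
density at x when x, y ≥ 0. -/
lemma normalTail_le_half_exp {y : ℝ} (hy : 0 ≤ y) :
    normalTail y ≤ Real.exp (-y ^ 2 / 2) / 2 := by
  have h0 : normalTail y = ∫ x in Set.Ioi 0, normalDensity (x + y) := by
    rw [normalTail_eq_integral]
    simpa using ((measurePreserving_add_right volume y).setIntegral_preimage_emb
      (measurableEmbedding_addRight y) normalDensity (Set.Ioi y)).symm
  have h1 : Real.exp (-y ^ 2 / 2) / 2 =
      ∫ x in Set.Ioi 0, Real.exp (-y ^ 2 / 2) * normalDensity x := by
    rw [integral_const_mul, ← normalTail_eq_integral, normalTail_zero]; ring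
  rw [h0, h1]
  refine setIntegral_mono_on (integrable_normalDensity.comp_add_right y).integrableOn
    (integrable_normalDensity.const_mul _).integrableOn measurableSet_Ioi fun x hx => ?_
  rw [normalDensity_eq, normalDensity_eq, mul_left_comm, ← Real.exp_add]
  gcongr
  have : 0 ≤ x * y := mul_nonneg (le_of_lt hx) hy
  nlinarith

/-- The hazard rate of the standard normal distribution. -/
noncomputable def hazard (x : ℝ) : ℝ := normalDensity x / normalTail x

lemma hazard_pos (x : ℝ) : 0 < hazard x := div_pos (normalDensity_pos x) (normalTail_pos x)

lemma hasDerivAt_normalDensity (x : ℝ) : HasDerivAt normalDensity (-x * normalDensity x) x := by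
  have : normalDensity = fun x => (√(2 * Real.pi))⁻¹ * Real.exp (-x ^ 2 / 2) :=
    funext normalDensity_eq
  rw [this]
  have h : HasDerivAt (fun x : ℝ => -x ^ 2 / 2) (-x) x := by
    refine (((hasDerivAt_pow 2 x).neg).div_const 2).congr_deriv ?_
    norm_num
    ring
  refine (h.exp.const_mul _).congr_deriv ?_
  ring

lemma tendsto_normalDensity_atTop : Tendsto normalDensity atTop (𝓝 0) := by
  have : normalDensity = fun x => (√(2 * Real.pi))⁻¹ * Real.exp (-x ^ 2 / 2) :=
    funext normalDensity_eq
  rw [this]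
  have h : Tendsto (fun x : ℝ => -x ^ 2 / 2) atTop atBot := by
    have := (tendsto_pow_atTop (α := ℝ) two_ne_zero).atTop_div_const (r := 2) two_pos
    simpa [neg_div, Function.comp_def] using tendsto_neg_atTop_atBot.comp this
  simpa using (Real.tendsto_exp_atBot.comp h).const_mul ((√(2 * Real.pi))⁻¹)

lemma le_of_antitoneOn_of_tendsto {f : ℝ → ℝ} {a l : ℝ} (hf : AntitoneOn f (Set.Ici a))
    (h : Tendsto f atTop (𝓝 l)) {x : ℝ} (hx : a ≤ x) : l ≤ f x :=
  le_of_tendsto h ((eventually_ge_atTop x).mono fun _ hy => hf hx (hx.trans hy) hy)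

lemma antitoneOn_of_hasDerivAt_nonpos {D : Set ℝ} (hD : Convex ℝ D) {f f' : ℝ → ℝ}
    (h : ∀ x ∈ D, HasDerivAt f (f' x) x) (hn : ∀ x ∈ D, f' x ≤ 0) : AntitoneOn f D := by
  refine antitoneOn_of_deriv_nonpos hD (fun x hx => (h x hx).continuousAt.continuousWithinAt)
    (fun x hx => (h x (interior_subset hx)).differentiableAt.differentiableWithinAt)
    fun x hx => ?_
  rw [(h x (interior_subset hx)).deriv]
  exact hn x (interior_subset hx)

lemma monotoneOn_of_hasDerivAt_nonneg {D : Set ℝ} (hD : Convex ℝ D) {f f' : ℝ → ℝ}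
    (h : ∀ x ∈ D, HasDerivAt f (f' x) x) (hn : ∀ x ∈ D, 0 ≤ f' x) : MonotoneOn f D := by
  refine monotoneOn_of_deriv_nonneg hD (fun x hx => (h x hx).continuousAt.continuousWithinAt)
    (fun x hx => (h x (interior_subset hx)).differentiableAt.differentiableWithinAt)
    fun x hx => ?_
  rw [(h x (interior_subset hx)).deriv]
  exact hn x (interior_subset hx)

lemma le_hazard (x : ℝ) : x ≤ hazard x := by
  rcases le_or_gt x 0 with h | h
  · exact h.trans (hazard_pos x).le
  rw [hazard, le_div_iff₀ (normalTail_pos x)]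
  have hd : ∀ u ∈ Set.Ici x, HasDerivAt (fun u => normalDensity u - x * normalTail u)
      ((x - u) * normalDensity u) u := by
    intro u _
    refine ((hasDerivAt_normalDensity u).sub ((hasDerivAt_normalTail u).const_mul x)).congr_deriv ?_
    ring
  have hA := antitoneOn_of_hasDerivAt_nonpos (convex_Ici x) hd fun u hu =>
    mul_nonpos_of_nonpos_of_nonneg (sub_nonpos.2 hu) (normalDensity_pos u).le
  have ht : Tendsto (fun u => normalDensity u - x * normalTail u) atTop (𝓝 0) := by
    simpa using tendsto_normalDensity_atTop.sub (tendsto_normalTail_atTop.const_mul x)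
  linarith [le_of_antitoneOn_of_tendsto hA ht le_rfl]

/-- The tangent line bound for the log-concave normal tail. -/
lemma normalTail_le_exp_hazard (x u : ℝ) :
    normalTail u ≤ normalTail x * Real.exp (-hazard x * (u - x)) := by
  set h := hazard x
  have hx : x ≤ h := le_hazard x
  have hh : 0 < h := hazard_pos x
  set D : ℝ → ℝ := fun u => normalTail x * Real.exp (-h * (u - x)) - normalTail u
  have hQ : normalTail x * h = normalDensity x := mul_div_cancel₀ _ (normalTail_pos x).ne'
  -- Since x ≤ h, the exponent changes sign at x and at 2h - x: D decreases up to x, increases on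
  -- [x, 2h - x], then decreases. With D(x) = 0 and limit 0 at infinity, D ≥ 0 everywhere.
  have hd : ∀ u, HasDerivAt D
      (normalDensity u * (1 - Real.exp ((u - x) * ((u + x) / 2 - h)))) u := by
    intro u
    have e1 : HasDerivAt (fun u : ℝ => -h * (u - x)) (-h) u := by
      simpa using ((hasDerivAt_id u).sub_const x).const_mul (-h)
    refine ((e1.exp.const_mul (normalTail x)).sub (hasDerivAt_normalTail u)).congr_deriv ?_
    have e2 : normalDensity u * Real.exp ((u - x) * ((u + x) / 2 - h)) =
        normalDensity x * Real.exp (-h * (u - x)) := by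
      rw [normalDensity_eq, normalDensity_eq, mul_assoc, mul_assoc, ← Real.exp_add, ← Real.exp_add]
      ring_nf
    rw [mul_sub (normalDensity u), e2, ← hQ]
    ring
  have hDx : D x = 0 := by simp [D]
  have hlim : Tendsto D atTop (𝓝 0) := by
    have h1 : Tendsto (fun u => Real.exp (-h * (u - x))) atTop (𝓝 0) := by
      refine Real.tendsto_exp_atBot.comp ?_
      exact (tendsto_atTop_add_const_right _ (-x) tendsto_id).const_mul_atTop_of_neg (by linarith)
    simpa only [mul_zero, sub_zero] using
      (h1.const_mul (normalTail x)).sub tendsto_normalTail_atTop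
  suffices 0 ≤ D u by simpa [D] using this
  rcases le_total u x with hu | hu
  · have hA := antitoneOn_of_hasDerivAt_nonpos (convex_Iic x) (fun u _ => hd u) fun u hu => by
      refine mul_nonpos_of_nonneg_of_nonpos (normalDensity_pos u).le ?_
      rw [sub_nonpos]
      refine Real.one_le_exp (mul_nonneg_of_nonpos_of_nonpos (sub_nonpos.2 hu) ?_)
      have : u ≤ x := hu
      linarith
    rw [← hDx]
    exact hA hu (Set.mem_Iic.2 le_rfl) hu
  rcases le_total u (2 * h - x) with hu2 | hu2
  · have hM := monotoneOn_of_hasDerivAt_nonneg (convex_Icc x (2 * h - x)) (fun u _ => hd u)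
      fun u hu => by
      refine mul_nonneg (normalDensity_pos u).le ?_
      rw [sub_nonneg]
      refine Real.exp_le_one_iff.2 (mul_nonpos_of_nonneg_of_nonpos (sub_nonneg.2 hu.1) ?_)
      linarith [hu.2]
    rw [← hDx]
    exact hM ⟨le_rfl, hu.trans hu2⟩ ⟨hu, hu2⟩ hu
  · have hA := antitoneOn_of_hasDerivAt_nonpos (convex_Ici (2 * h - x)) (fun u _ => hd u)
      fun u hu => by
      have hu' : 2 * h - x ≤ u := hu
      refine mul_nonpos_of_nonneg_of_nonpos (normalDensity_pos u).le ?_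
      rw [sub_nonpos]
      exact Real.one_le_exp (mul_nonneg (by linarith) (by linarith))
    exact le_of_antitoneOn_of_tendsto hA hlim hu2

/-- Layer-cake formula: E(Z - t)₊³ = 3 ∫ s² P(Z ≥ t + s) ds over s > 0, and the exponential bound
turns this into a Gamma integral, with 6 = 3 Γ(3). -/
lemma gaussCube_le_of_tail {A h t : ℝ} (hh : 0 < h)
    (hA : ∀ u, normalTail u ≤ A * Real.exp (-h * u)) :
    gaussCube 1 (-t) ≤ A * Real.exp (-h * t) * (6 / h ^ 3) := by
  have hA0 : 0 ≤ A := by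
    have := (normalTail_nonneg 0).trans (hA 0)
    simpa using this
  set f : ℝ → ℝ := fun z => max (-t + z) 0
  have hf : AEMeasurable f (gaussianReal 0 1) := by fun_prop
  have h0 := lintegral_rpow_eq_lintegral_meas_le_mul (gaussianReal 0 1) (f := f)
    (ae_of_all _ fun z => le_max_right _ _) hf (p := 3) (by norm_num)
  have hpow : ∀ z, f z ^ (3 : ℝ) = cubePos (-t + z) := by
    intro z
    simp only [f, cubePos]
    exact_mod_cast Real.rpow_natCast (max (-t + z) 0) 3
  have hint := Real.integral_rpow_mul_exp_neg_mul_Ioi (a := 3) (r := h) (by norm_num) hh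
  have hG : Real.Gamma 3 = 2 := by
    have := Real.Gamma_nat_eq_factorial 2
    norm_num at this ⊢
  have hle : ∫⁻ s in Set.Ioi 0, (gaussianReal 0 1) {a | s ≤ f a} * ENNReal.ofReal (s ^ ((3 : ℝ) - 1)) ≤
      ∫⁻ s in Set.Ioi 0, ENNReal.ofReal (A * Real.exp (-h * t) *
        (s ^ ((3 : ℝ) - 1) * Real.exp (-(h * s)))) := by
    refine setLIntegral_mono' measurableSet_Ioi fun s hs => ?_
    have hs0 : (0 : ℝ) < s := hs
    have hset : {a | s ≤ f a} = {z : ℝ | t + s ≤ z} := by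
      ext z
      simp only [f, Set.mem_ofPred_eq, le_max_iff]
      constructor
      · rintro (h1 | h1) <;> linarith
      · intro h1
        left; linarith
    have hb := hA (t + s)
    have hm : (gaussianReal 0 1) {a | s ≤ f a} = ENNReal.ofReal (normalTail (t + s)) := by
      rw [hset, normalTail, ofReal_measureReal]
    rw [hm, ← ENNReal.ofReal_mul (normalTail_nonneg _)]
    refine ENNReal.ofReal_le_ofReal ?_
    have e : A * Real.exp (-h * t) * (s ^ ((3 : ℝ) - 1) * Real.exp (-(h * s))) =
        A * Real.exp (-h * (t + s)) * s ^ ((3 : ℝ) - 1) := by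
      rw [mul_add, Real.exp_add, neg_mul h s]; ring
    rw [e]
    gcongr
  have hi : IntegrableOn (fun s : ℝ => s ^ ((3 : ℝ) - 1) * Real.exp (-(h * s))) (Set.Ioi 0) := by
    -- A non-integrable function has integral 0 by convention, but the Gamma formula gives a
    -- positive value.
    by_contra hc
    rw [integral_undef hc, hG] at hint
    have : 0 < (1 / h) ^ (3 : ℝ) * 2 := by positivity
    linarith
  rw [← ofReal_integral_eq_lintegral_ofReal (hi.const_mul _)
    ((ae_restrict_iff' measurableSet_Ioi).2 (ae_of_all _ fun s hs => by
      have hs0 : (0 : ℝ) < s := hs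
      simp only [Pi.zero_apply]
      positivity)), integral_const_mul, hint, hG] at hle
  rw [gaussCube, integral_eq_lintegral_of_nonneg_ae (ae_of_all _ fun z => cubePos_nonneg _)
    (integrable_cubePos _ _ _).aestronglyMeasurable]
  refine ENNReal.toReal_le_of_le_ofReal (by positivity) ?_
  simp only [hpow] at h0
  rw [h0]
  refine (mul_le_mul_right hle _).trans ?_
  rw [← ENNReal.ofReal_mul (by norm_num)]
  refine ENNReal.ofReal_le_ofReal (le_of_eq ?_)
  have : (1 / h) ^ (3 : ℝ) = (1 / h) ^ 3 := by exact_mod_cast Real.rpow_natCast (1 / h) 3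
  rw [this]
  field_simp
  ring

/-- With y = h(x - t), the exponential bound divided by (x - t)³ is `normalTail x` times 6 e^y / y³,
which is least at y = 3. Its value 2e³/9 there is the origin of `lam`. -/
lemma exists_gaussCube_le (x : ℝ) :
    ∃ t < x, gaussCube 1 (-t) ≤ (2 * Real.exp 3 / 9) * normalTail x * (x - t) ^ 3 := by
  set h := hazard x
  have hh : 0 < h := hazard_pos x
  refine ⟨x - 3 / h, by linarith [div_pos three_pos hh], ?_⟩
  have := gaussCube_le_of_tail (A := normalTail x * Real.exp (h * x)) (t := x - 3 / h) hh
    fun u => (normalTail_le_exp_hazard x u).trans (le_of_eq ?_)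
  · refine this.trans (le_of_eq ?_)
    rw [mul_assoc (normalTail x), ← Real.exp_add]
    have e : h * x + -h * (x - 3 / h) = 3 := by field_simp; ring
    rw [e]
    field_simp
    ring
  · rw [mul_assoc, ← Real.exp_add]
    congr 2
    ring

/-! ### The constant λ and the shifted tail -/

lemma exp_lam : Real.exp lam = 2 * Real.exp 3 / 9 := Real.exp_log (by positivity)

lemma sq_le_lam : (1.22 : ℝ) ^ 2 ≤ lam := by
  rw [← Real.exp_le_exp, exp_lam]
  have h1 : Real.exp 3 = Real.exp (1.22 ^ 2) * (Real.exp 1 * Real.exp 0.5116) := by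
    rw [← Real.exp_add, ← Real.exp_add]; norm_num
  have h2 : (1.667 : ℝ) ≤ Real.exp 0.5116 := by
    have := Real.sum_le_exp_of_nonneg (x := 0.5116) (by norm_num) 5
    norm_num [Finset.sum_range_succ, Nat.factorial] at this ⊢
    linarith
  have h3 := Real.exp_one_gt_d9
  have h4 : (4.5 : ℝ) ≤ Real.exp 1 * Real.exp 0.5116 := by nlinarith
  have := Real.exp_pos (1.22 ^ 2)
  rw [h1]
  nlinarith

lemma lam_pos : 0 < lam := lt_of_lt_of_le (by norm_num) sq_le_lam

lemma exp_neg_le_quadratic {y : ℝ} (hy : 0 ≤ y) : Real.exp (-y) ≤ 1 - y + y ^ 2 / 2 := by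
  have hd : ∀ u ∈ Set.Ici (0 : ℝ), HasDerivAt (fun u => 1 - u + u ^ 2 / 2 - Real.exp (-u))
      (Real.exp (-u) - (1 - u)) u := by
    intro u _
    refine ((((hasDerivAt_id u).const_sub 1).add ((hasDerivAt_pow 2 u).div_const 2)).sub
      ((hasDerivAt_neg u).exp)).congr_deriv ?_
    simp
    ring
  have := monotoneOn_of_hasDerivAt_nonneg (convex_Ici 0) hd
    (fun u _ => sub_nonneg.2 (Real.one_sub_le_exp_neg u)) (Set.mem_Ici.2 le_rfl) hy hy
  simp at this
  linarith

lemma cubic_le_exp_neg {y : ℝ} (hy : 0 ≤ y) :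
    1 - y + y ^ 2 / 2 - y ^ 3 / 6 ≤ Real.exp (-y) := by
  have hd : ∀ u ∈ Set.Ici (0 : ℝ),
      HasDerivAt (fun u => Real.exp (-u) - (1 - u + u ^ 2 / 2 - u ^ 3 / 6))
      (1 - u + u ^ 2 / 2 - Real.exp (-u)) u := by
    intro u _
    refine (((hasDerivAt_neg u).exp).sub ((((hasDerivAt_id u).const_sub 1).add
      ((hasDerivAt_pow 2 u).div_const 2)).sub ((hasDerivAt_pow 3 u).div_const 6))).congr_deriv ?_
    simp
    ring
  have := monotoneOn_of_hasDerivAt_nonneg (convex_Ici 0) hd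
    (fun u hu => sub_nonneg.2 (exp_neg_le_quadratic hu)) (Set.mem_Ici.2 le_rfl) hy hy
  simp at this
  linarith

/-- The cubic Taylor lower bound for exp(-y) at y = u²/2, integrated over [0, a]. -/
lemma normalTail_le_polynomial {a : ℝ} (ha : 0 ≤ a) :
    normalTail a ≤
      1 / 2 - (√(2 * Real.pi))⁻¹ * (a - a ^ 3 / 6 + a ^ 5 / 40 - a ^ 7 / 336) := by
  have hd : ∀ u ∈ Set.Ici (0 : ℝ), HasDerivAt (fun u =>
      1 / 2 - (√(2 * Real.pi))⁻¹ * (u - u ^ 3 / 6 + u ^ 5 / 40 - u ^ 7 / 336) - normalTail u)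
      ((√(2 * Real.pi))⁻¹ * (Real.exp (-(u ^ 2 / 2)) -
        (1 - u ^ 2 / 2 + (u ^ 2 / 2) ^ 2 / 2 - (u ^ 2 / 2) ^ 3 / 6))) u := by
    intro u _
    refine (((((((hasDerivAt_id u).sub ((hasDerivAt_pow 3 u).div_const 6)).add
      ((hasDerivAt_pow 5 u).div_const 40)).sub ((hasDerivAt_pow 7 u).div_const 336)).const_mul
      (√(2 * Real.pi))⁻¹).const_sub (1 / 2)).sub (hasDerivAt_normalTail u)).congr_deriv ?_
    rw [normalDensity_eq, neg_div]
    push_cast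
    ring
  have := monotoneOn_of_hasDerivAt_nonneg (convex_Ici 0) hd
    (fun u hu => mul_nonneg (by positivity)
      (sub_nonneg.2 (cubic_le_exp_neg (by positivity)))) (Set.mem_Ici.2 le_rfl) ha ha
  norm_num [normalTail_zero] at this
  norm_num
  linarith

lemma exp_lam_mul_normalTail_sqrt_lam_le : Real.exp lam * normalTail (√lam) ≤ 1 / 2 := by
  have h1 : normalTail (√lam) ≤ normalTail 1.22 := normalTail_antitone (Real.le_sqrt_of_sq_le sq_le_lam)
  have h2 := normalTail_le_polynomial (a := 1.22) (by norm_num)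
  have hs : √(2 * Real.pi) ≤ 2.50663 := by
    rw [Real.sqrt_le_left (by norm_num)]
    have := Real.pi_lt_d6
    norm_num
    linarith
  have hs0 : 0 < √(2 * Real.pi) := by positivity
  have h3 : (2.50663 : ℝ)⁻¹ ≤ (√(2 * Real.pi))⁻¹ := inv_anti₀ hs0 hs
  have h4 : normalTail (√lam) ≤ 0.11185 := by
    refine h1.trans (h2.trans ?_)
    norm_num at h3 ⊢
    linarith
  have h5 : Real.exp 3 ≤ 20.0856 := by
    have e : Real.exp 3 = Real.exp 1 ^ 3 := by rw [← Real.exp_nat_mul]; norm_num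
    rw [e]
    calc Real.exp 1 ^ 3 ≤ 2.7182818286 ^ 3 := by
          gcongr
          exact Real.exp_one_lt_d9.le
      _ ≤ 20.0856 := by norm_num
  rw [exp_lam]
  have := normalTail_nonneg (√lam)
  have := Real.exp_pos 3
  nlinarith

/-- By concavity of the logarithm, log(1 + w) / w decreases in w. This gives the derivative of the
shifted tail difference a single sign change. -/
lemma mul_log_one_add_le {w w' : ℝ} (h0 : 0 < w') (h : w' ≤ w) :
    w' * Real.log (1 + w) ≤ w * Real.log (1 + w') := by
  have hw : 0 < w := h0.trans_le h
  have hw1 : 1 + w ∈ Set.Ioi (0 : ℝ) := Set.mem_Ioi.2 (by linarith)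
  have ha : 0 ≤ w' / w := by positivity
  have hb : 0 ≤ 1 - w' / w := sub_nonneg.2 ((div_le_one hw).2 h)
  have hc := strictConcaveOn_log_Ioi.concaveOn.2 hw1 (Set.mem_Ioi.2 one_pos) ha hb (by ring)
  have e : w' / w * (1 + w) + (1 - w' / w) * 1 = 1 + w' := by field_simp; ring
  simp only [smul_eq_mul, Real.log_one, mul_zero, add_zero] at hc
  rw [e, div_mul_eq_mul_div, div_le_iff₀ hw] at hc
  linarith

lemma hasDerivAt_shifted_normalTail_sub {x : ℝ} (hx : 0 < x) :
    HasDerivAt (fun x => normalTail (x - lam / x) - Real.exp lam * normalTail x)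
      (Real.exp lam * normalDensity x *
        (1 - Real.exp (Real.log (1 + lam / x ^ 2) - lam * (lam / x ^ 2) / 2))) x := by
  have hx0 := hx.ne'
  have h1 : HasDerivAt (fun x : ℝ => x - lam / x) (1 + lam / x ^ 2) x := by
    refine ((hasDerivAt_id x).sub ((hasDerivAt_inv hx0).const_mul lam)).congr_deriv ?_
    field_simp
    ring
  refine (((hasDerivAt_normalTail _).comp x h1).sub
    ((hasDerivAt_normalTail x).const_mul _)).congr_deriv ?_
  have hw : 0 < 1 + lam / x ^ 2 := by have := lam_pos; positivity
  have e : normalDensity (x - lam / x) =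
      Real.exp lam * normalDensity x * Real.exp (-(lam * (lam / x ^ 2) / 2)) := by
    rw [normalDensity_eq, normalDensity_eq, mul_left_comm, mul_assoc, ← Real.exp_add,
      ← Real.exp_add]
    congr 2
    field_simp
    ring
  rw [sub_eq_add_neg (Real.log _), Real.exp_add, Real.exp_log hw, e]
  ring

/-- The Gaussian tail comparison with the shift `lam / x`. -/
lemma exp_lam_mul_normalTail_le {x : ℝ} (hx : √lam ≤ x) :
    Real.exp lam * normalTail x ≤ normalTail (x - lam / x) := by
  have hl := lam_pos
  have hs : 0 < √lam := Real.sqrt_pos.2 hl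
  have hx0 : 0 < x := hs.trans_le hx
  have hneg : ∀ u, 0 < u → 0 < Real.exp lam * normalDensity u := fun u _ =>
    mul_pos (Real.exp_pos _) (normalDensity_pos u)
  rw [← sub_nonneg]
  -- With w = λ/x², log(1 + w) / w increases in x, so the difference first increases and then
  -- decreases. It is compared with its limit 0 at infinity on the decreasing part, and with its
  -- value at √λ on the increasing part.
  rcases le_total 0 (Real.log (1 + lam / x ^ 2) - lam * (lam / x ^ 2) / 2) with h | h
  · have hA := antitoneOn_of_hasDerivAt_nonpos (convex_Ici x)
      (fun u hu => hasDerivAt_shifted_normalTail_sub (hx0.trans_le hu)) fun u hu => by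
      have hu' : x ≤ u := hu
      have hu0 : 0 < u := hx0.trans_le hu
      refine mul_nonpos_of_nonneg_of_nonpos (hneg u hu0).le (sub_nonpos.2 (Real.one_le_exp ?_))
      have h1 := mul_log_one_add_le (w := lam / x ^ 2) (w' := lam / u ^ 2) (by positivity)
        (by gcongr)
      have hw' : 0 < lam / u ^ 2 := by positivity
      have hw : 0 < lam / x ^ 2 := by positivity
      refine nonneg_of_mul_nonneg_right ?_ hw
      nlinarith [mul_nonneg hw'.le h]
    have ht : Tendsto (fun x => normalTail (x - lam / x) - Real.exp lam * normalTail x) atTop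
        (𝓝 0) := by
      have h1 : Tendsto (fun x : ℝ => x - lam / x) atTop atTop := by
        have := (tendsto_inv_atTop_zero (𝕜 := ℝ)).const_mul (-lam)
        simpa [sub_eq_add_neg, div_eq_mul_inv] using tendsto_id.atTop_add this
      simpa using (tendsto_normalTail_atTop.comp h1).sub
        (tendsto_normalTail_atTop.const_mul (Real.exp lam))
    exact le_of_antitoneOn_of_tendsto hA ht le_rfl
  · have hM := monotoneOn_of_hasDerivAt_nonneg (convex_Icc (√lam) x)
      (fun u hu => hasDerivAt_shifted_normalTail_sub (hs.trans_le hu.1)) fun u hu => by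
      have hu0 : 0 < u := hs.trans_le hu.1
      have hu' := hu.2
      refine mul_nonneg (hneg u hu0).le (sub_nonneg.2 (Real.exp_le_one_iff.2 ?_))
      have h1 := mul_log_one_add_le (w := lam / u ^ 2) (w' := lam / x ^ 2) (by positivity)
        (by gcongr)
      have hw' : 0 < lam / u ^ 2 := by positivity
      have hw : 0 < lam / x ^ 2 := by positivity
      refine nonpos_of_mul_nonpos_right ?_ hw
      nlinarith [mul_nonneg hw'.le (neg_nonneg.2 h)]
    refine le_trans ?_ (hM ⟨le_rfl, hx⟩ ⟨hx, le_rfl⟩ hx)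
    have e : √lam - lam / √lam = 0 := by rw [Real.div_sqrt, sub_self]
    simp only [e, normalTail_zero]
    linarith [exp_lam_mul_normalTail_sqrt_lam_le]

lemma inv_one_add_sq_le_normalTail {x : ℝ} (hx : 0 < x) (hxl : x ≤ √lam) :
    1 / (1 + x ^ 2) ≤ normalTail (x - lam / x) := by
  set y := lam / x - x
  have hl := sq_le_lam
  have hx2 : x ^ 2 ≤ lam := by
    rw [← Real.sq_sqrt lam_pos.le]; gcongr
  have hy : 0 ≤ y := by
    have : x ≤ lam / x := (le_div_iff₀ hx).2 (by nlinarith)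
    simp only [y]; linarith
  have hxy : x * y = lam - x ^ 2 := by simp only [y]; field_simp
  have e : x - lam / x = -y := by simp only [y]; ring
  rw [e, normalTail_neg]
  have h1 := normalTail_le_half_exp hy
  have h2 : Real.exp (-y ^ 2 / 2) ≤ 1 / (1 + y ^ 2 / 2) := by
    rw [neg_div, Real.exp_neg, one_div]
    refine inv_anti₀ (by positivity) ?_
    linarith [Real.add_one_le_exp (y ^ 2 / 2)]
  have h3 : 1 / (1 + y ^ 2 / 2) / 2 ≤ 1 - 1 / (1 + x ^ 2) := by
    have e1 : 1 - 1 / (1 + x ^ 2) = x ^ 2 / (1 + x ^ 2) := by field_simp; ring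
    have e2 : 1 / (1 + y ^ 2 / 2) / 2 = 1 / (2 + y ^ 2) := by field_simp
    rw [e1, e2, div_le_div_iff₀ (by positivity) (by positivity)]
    have : x ^ 2 * y ^ 2 = (lam - x ^ 2) ^ 2 := by rw [← hxy]; ring
    -- It remains to see 1 ≤ x² + (λ - x²)². The right side is at least λ - 1/4, with equality at λ
    -- - x² = 1/2.
    nlinarith [sq_nonneg (lam - x ^ 2 - 1 / 2)]
  linarith

/-! ### Bounded martingale differences and the supermartingale method -/

/-- A real martingale difference sequence bounded by `1`; `ξ i` is the increment from time `i` to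
time `i + 1`. -/
structure IsUnitMartingaleDiff {Ω : Type*} {mΩ : MeasurableSpace Ω} (μ : Measure Ω)
    (𝒢 : Filtration ℕ mΩ) (ξ : ℕ → Ω → ℝ) : Prop where
  measurable : ∀ i, StronglyMeasurable[𝒢 (i + 1)] (ξ i)
  condExp_eq : ∀ i, μ[ξ i | 𝒢 i] =ᵐ[μ] 0
  bound : ∀ i, ∀ᵐ ω ∂μ, |ξ i ω| ≤ 1

/-- A real function on a normed space that is bounded on bounded sets. -/
def BoundedOnBalls {E : Type*} [NormedAddCommGroup E] (G : E → ℝ) : Prop :=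
  ∀ r : ℝ, ∃ M : ℝ, ∀ a, ‖a‖ ≤ r → |G a| ≤ M

lemma BoundedOnBalls.of_continuous {E : Type*} [NormedAddCommGroup E] [ProperSpace E] {G : E → ℝ}
    (hG : Continuous G) : BoundedOnBalls G := fun r => by
  obtain ⟨M, hM⟩ := (isCompact_closedBall (0 : E) r).exists_bound_of_continuousOn hG.continuousOn
  exact ⟨M, fun a ha => hM a (by simpa using ha)⟩

lemma BoundedOnBalls.comp_norm {E : Type*} [NormedAddCommGroup E] {f : ℝ → ℝ}
    (hf : Continuous f) : BoundedOnBalls fun a : E => f ‖a‖ := fun r => by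
  obtain ⟨M, hM⟩ := BoundedOnBalls.of_continuous hf r
  exact ⟨M, fun a ha => hM _ (by simpa using ha)⟩

lemma BoundedOnBalls.comp_add {E : Type*} [NormedAddCommGroup E] {G : E → ℝ}
    (hG : BoundedOnBalls G) (x : E) : BoundedOnBalls fun a => G (a + x) := fun r => by
  obtain ⟨M, hM⟩ := hG (r + ‖x‖)
  exact ⟨M, fun a ha => hM _ ((norm_add_le _ _).trans (by gcongr))⟩

lemma BoundedOnBalls.comp_sub {E : Type*} [NormedAddCommGroup E] {G : E → ℝ}
    (hG : BoundedOnBalls G) (x : E) : BoundedOnBalls fun a => G (a - x) := by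
  simpa only [sub_eq_add_neg] using hG.comp_add (-x)

section

variable {Ω : Type*} {mΩ : MeasurableSpace Ω} {μ : Measure Ω}
  {E : Type*} [NormedAddCommGroup E]

lemma BoundedOnBalls.exists_ae_bound {G : E → ℝ} (hG : BoundedOnBalls G) {A : Ω → E}
    (hA : ∃ C : ℝ, ∀ᵐ ω ∂μ, ‖A ω‖ ≤ C) : ∃ M : ℝ, ∀ᵐ ω ∂μ, ‖G (A ω)‖ ≤ M := by
  obtain ⟨C, hC⟩ := hA
  obtain ⟨M, hM⟩ := hG C
  exact ⟨M, hC.mono fun ω h => hM _ h⟩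

lemma BoundedOnBalls.integrable_comp [IsFiniteMeasure μ] {G : E → ℝ} (hG : BoundedOnBalls G)
    (hGc : Continuous G) {A : Ω → E} (hAm : AEStronglyMeasurable A μ)
    (hA : ∃ C : ℝ, ∀ᵐ ω ∂μ, ‖A ω‖ ≤ C) : Integrable (fun ω => G (A ω)) μ := by
  obtain ⟨M, hM⟩ := hG.exists_ae_bound hA
  exact Integrable.of_bound (hGc.comp_aestronglyMeasurable hAm) M hM

lemma condExp_mul_eq_zero [IsFiniteMeasure μ] {m : MeasurableSpace Ω} (hm : m ≤ mΩ)
    {W ξ : Ω → ℝ} (hW : StronglyMeasurable[m] W) (hWb : ∃ M : ℝ, ∀ᵐ ω ∂μ, ‖W ω‖ ≤ M)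
    (hξ : Integrable ξ μ) (hc : μ[ξ | m] =ᵐ[μ] 0) : μ[W * ξ | m] =ᵐ[μ] 0 := by
  obtain ⟨M, hM⟩ := hWb
  filter_upwards [condExp_stronglyMeasurable_mul_of_bound hm hW hξ M hM, hc] with ω h1 h2
  rw [h1, Pi.mul_apply, h2]
  simp

variable [NormedSpace ℝ E]

/-- The chord between a - x and a + x is affine in s. Its linear term has zero mean once s is a
centred increment. -/
lemma convex_two_point_le {G : E → ℝ} (hG : ConvexOn ℝ Set.univ G) (a x : E) {s : ℝ}
    (hs : |s| ≤ 1) :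
    G (a + s • x) ≤ (G (a + x) + G (a - x)) / 2 + (G (a + x) - G (a - x)) / 2 * s := by
  have h := abs_le.1 hs
  have h1 : 0 ≤ (1 + s) / 2 := by linarith
  have h2 : 0 ≤ (1 - s) / 2 := by linarith
  have := hG.2 (Set.mem_univ (a + x)) (Set.mem_univ (a - x)) h1 h2 (by ring)
  have e : ((1 + s) / 2) • (a + x) + ((1 - s) / 2) • (a - x) = a + s • x := by module
  rw [e] at this
  simp only [smul_eq_mul] at this
  linarith

/-- Among the bounded centred increments in a fixed direction, the symmetric two-point one is
extremal for convex functions. -/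
lemma integral_convex_step_le [IsFiniteMeasure μ] {m : MeasurableSpace Ω} (hm : m ≤ mΩ)
    {A : Ω → E} (hAm : StronglyMeasurable[m] A) (hA : ∃ C : ℝ, ∀ᵐ ω ∂μ, ‖A ω‖ ≤ C)
    {ξ : Ω → ℝ} (hξm : AEStronglyMeasurable[mΩ] ξ μ) (hξ : ∀ᵐ ω ∂μ, |ξ ω| ≤ 1)
    (hc : μ[ξ | m] =ᵐ[μ] 0) (x : E) {G : E → ℝ} (hG : ConvexOn ℝ Set.univ G)
    (hGc : Continuous G) (hGb : BoundedOnBalls G) :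
    ∫ ω, G (A ω + ξ ω • x) ∂μ ≤ ∫ ω, (G (A ω + x) + G (A ω - x)) / 2 ∂μ := by
  have hA' : AEStronglyMeasurable[mΩ] A μ := (hAm.mono hm).aestronglyMeasurable
  have i1 := (hGb.comp_add x).integrable_comp (hGc.comp (by fun_prop)) hA' hA
  have i2 := (hGb.comp_sub x).integrable_comp (hGc.comp (by fun_prop)) hA' hA
  set W : Ω → ℝ := fun ω => (G (A ω + x) - G (A ω - x)) / 2
  have hWm : StronglyMeasurable[m] W := by
    have hc : Continuous fun a => (G (a + x) - G (a - x)) / 2 := by fun_prop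
    exact hc.comp_stronglyMeasurable hAm
  have hWb : ∃ M : ℝ, ∀ᵐ ω ∂μ, ‖W ω‖ ≤ M := by
    obtain ⟨M1, h1⟩ := (hGb.comp_add x).exists_ae_bound hA
    obtain ⟨M2, h2⟩ := (hGb.comp_sub x).exists_ae_bound hA
    refine ⟨(M1 + M2) / 2, ?_⟩
    filter_upwards [h1, h2] with ω h1 h2
    simp only [W, norm_div]
    rw [Real.norm_of_nonneg (zero_le_two (α := ℝ))]
    have := norm_sub_le (G (A ω + x)) (G (A ω - x))
    linarith
  have hξi : Integrable ξ μ := Integrable.of_bound hξm 1 hξ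
  have hWξ : Integrable (W * ξ) μ := by
    obtain ⟨M, hM⟩ := hWb
    exact hξi.bdd_mul (hWm.mono hm).aestronglyMeasurable hM
  have h0 : ∫ ω, (W * ξ) ω ∂μ = 0 := by
    rw [← integral_condExp hm, integral_congr_ae (condExp_mul_eq_zero hm hWm hWb hξi hc)]
    simp
  have hAξ : ∃ C : ℝ, ∀ᵐ ω ∂μ, ‖A ω + ξ ω • x‖ ≤ C := by
    obtain ⟨C, hC⟩ := hA
    refine ⟨C + ‖x‖, ?_⟩
    filter_upwards [hC, hξ] with ω h1 h2
    refine (norm_add_le _ _).trans (add_le_add h1 ?_)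
    rw [norm_smul]
    exact mul_le_of_le_one_left (norm_nonneg x) h2
  have i3 : Integrable (fun ω => (G (A ω + x) + G (A ω - x)) / 2) μ := (i1.add i2).div_const 2
  have hi := hGb.integrable_comp hGc (hA'.add (hξm.smul_const x)) hAξ
  calc ∫ ω, G (A ω + ξ ω • x) ∂μ
      ≤ ∫ ω, ((G (A ω + x) + G (A ω - x)) / 2 + (W * ξ) ω) ∂μ :=
        integral_mono_ae hi (i3.add hWξ)
          (hξ.mono fun ω h => convex_two_point_le hG (A ω) x h)
    _ = _ := by rw [integral_add i3 hWξ, h0, add_zero]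

namespace IsUnitMartingaleDiff

variable {𝒢 : Filtration ℕ mΩ} {ξ : ℕ → Ω → ℝ}

lemma stronglyMeasurable_sum (h : IsUnitMartingaleDiff μ 𝒢 ξ) (x : ℕ → E) (n : ℕ) :
    StronglyMeasurable[𝒢 n] fun ω => ∑ i ∈ Finset.range n, ξ i ω • x i := by
  refine Finset.stronglyMeasurable_fun_sum _ fun i hi => ?_
  exact ((h.measurable i).mono (𝒢.mono (Finset.mem_range.1 hi))).smul_const (x i)

lemma aestronglyMeasurable_sum (h : IsUnitMartingaleDiff μ 𝒢 ξ) (x : ℕ → E) (n : ℕ) :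
    AEStronglyMeasurable (fun ω => ∑ i ∈ Finset.range n, ξ i ω • x i) μ :=
  ((h.stronglyMeasurable_sum x n).mono (𝒢.le n)).aestronglyMeasurable

lemma exists_bound_sum (h : IsUnitMartingaleDiff μ 𝒢 ξ) (x : ℕ → E) (n : ℕ) :
    ∃ C : ℝ, ∀ᵐ ω ∂μ, ‖∑ i ∈ Finset.range n, ξ i ω • x i‖ ≤ C := by
  refine ⟨∑ i ∈ Finset.range n, ‖x i‖, ?_⟩
  filter_upwards [ae_all_iff.2 h.bound] with ω hω
  refine norm_sum_le_of_le _ fun i _ => ?_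
  rw [norm_smul]
  exact mul_le_of_le_one_left (norm_nonneg _) (hω i)

lemma integrable_comp_sum [IsFiniteMeasure μ] (h : IsUnitMartingaleDiff μ 𝒢 ξ) (x : ℕ → E)
    (n : ℕ) {G : E → ℝ} (hGc : Continuous G) (hGb : BoundedOnBalls G) :
    Integrable (fun ω => G (∑ i ∈ Finset.range n, ξ i ω • x i)) μ :=
  hGb.integrable_comp hGc (h.aestronglyMeasurable_sum x n) (h.exists_bound_sum x n)

/-- The supermartingale method: functions that decrease under symmetric two-point steps bound the
expectation along the whole sum. -/
lemma integral_potential_le [IsProbabilityMeasure μ] (h : IsUnitMartingaleDiff μ 𝒢 ξ) (x : ℕ → E)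
    {V : ℕ → E → ℝ} (hV : ∀ i, ConvexOn ℝ Set.univ (V i)) (hVc : ∀ i, Continuous (V i))
    (hVb : ∀ i, BoundedOnBalls (V i))
    (hstep : ∀ i a, (V (i + 1) (a + x i) + V (i + 1) (a - x i)) / 2 ≤ V i a) (n : ℕ) :
    ∫ ω, V n (∑ i ∈ Finset.range n, ξ i ω • x i) ∂μ ≤ V 0 0 := by
  induction n with
  | zero => simp
  | succ n ih =>
    refine le_trans ?_ ih
    simp only [Finset.sum_range_succ]
    refine (integral_convex_step_le (𝒢.le n) (h.stronglyMeasurable_sum x n)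
      (h.exists_bound_sum x n) ((h.measurable n).mono (𝒢.le _)).aestronglyMeasurable (h.bound n)
      (h.condExp_eq n) (x n) (hV _) (hVc _) (hVb _)).trans ?_
    refine integral_mono ((Integrable.add ?_ ?_).div_const 2)
      (h.integrable_comp_sum x n (hVc n) (hVb n)) fun ω => hstep n _
    · exact h.integrable_comp_sum x n (G := fun a => V (n + 1) (a + x n))
        ((hVc _).comp (by fun_prop)) ((hVb _).comp_add _)
    · exact h.integrable_comp_sum x n (G := fun a => V (n + 1) (a - x n))
        ((hVc _).comp (by fun_prop)) ((hVb _).comp_sub _)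

lemma shift (h : IsUnitMartingaleDiff μ 𝒢 ξ) (m : ℕ) :
    IsUnitMartingaleDiff μ
      (⟨fun n => 𝒢 (m + n), fun _ _ hij => 𝒢.mono (by gcongr), fun n => 𝒢.le _⟩ : Filtration ℕ mΩ)
      fun i => ξ (m + i) :=
  ⟨fun i => h.measurable (m + i), fun i => h.condExp_eq (m + i), fun i => h.bound (m + i)⟩

end IsUnitMartingaleDiff

end

/-! ### Moment bounds from suitable potentials -/

lemma convexOn_norm_add_sq {E : Type*} [NormedAddCommGroup E] [NormedSpace ℝ E] (b : E) :
    ConvexOn ℝ Set.univ fun a : E => ‖a + b‖ ^ 2 := by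
  have h := (convexOn_univ_norm (E := E)).pow (fun _ _ => norm_nonneg _) 2
  exact h.translate_left b

namespace IsUnitMartingaleDiff

variable {Ω : Type*} {mΩ : MeasurableSpace Ω} {μ : Measure Ω} {𝒢 : Filtration ℕ mΩ}
  {ξ : ℕ → Ω → ℝ} {E : Type*} [NormedAddCommGroup E] [InnerProductSpace ℝ E]

lemma boundedOnBalls_norm_add_sq {F : Type*} [NormedAddCommGroup F] (b : F) :
    BoundedOnBalls fun a : F => ‖a + b‖ ^ 2 :=
  (BoundedOnBalls.comp_norm (f := fun y => y ^ 2) (by fun_prop)).comp_add b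

/-- Subtracting the variance spent so far makes the potential exactly invariant under two-point
steps. The shift b serves Cantelli's inequality. -/
lemma integral_norm_add_sq_le [IsProbabilityMeasure μ] (h : IsUnitMartingaleDiff μ 𝒢 ξ)
    (x : ℕ → E) (b : E) (n : ℕ) :
    ∫ ω, ‖(∑ i ∈ Finset.range n, ξ i ω • x i) + b‖ ^ 2 ∂μ ≤
      ‖b‖ ^ 2 + ∑ i ∈ Finset.range n, ‖x i‖ ^ 2 := by
  have hV := h.integral_potential_le x
    (V := fun n a => ‖a + b‖ ^ 2 + -∑ i ∈ Finset.range n, ‖x i‖ ^ 2)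
    (fun i => (convexOn_norm_add_sq b).add_const _) (fun i => by fun_prop) (fun i r => ?_) ?_ n
  · rw [integral_add (h.integrable_comp_sum x n (G := fun a => ‖a + b‖ ^ 2) (by fun_prop)
      (boundedOnBalls_norm_add_sq b)) (integrable_const _)] at hV
    simp at hV
    linarith
  · obtain ⟨M, hM⟩ := boundedOnBalls_norm_add_sq b r
    exact ⟨M + |-∑ i ∈ Finset.range i, ‖x i‖ ^ 2|,
      fun a ha => (abs_add_le _ _).trans (add_le_add (hM a ha) le_rfl)⟩
  · intro i a
    have hp := parallelogram_law_with_norm ℝ (a + b) (x i)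
    rw [Finset.sum_range_succ, add_right_comm a, show a - x i + b = a + b - x i by abel]
    nlinarith

lemma integral_exp_le [IsProbabilityMeasure μ] (h : IsUnitMartingaleDiff μ 𝒢 ξ)
    (c : ℕ → ℝ) (s : ℝ) (n : ℕ) :
    ∫ ω, Real.exp (s * ∑ i ∈ Finset.range n, ξ i ω • c i) ∂μ ≤
      Real.exp (s ^ 2 / 2 * ∑ i ∈ Finset.range n, c i ^ 2) := by
  have hV := h.integral_potential_le c
    (V := fun n a => Real.exp (-(s ^ 2 / 2 * ∑ i ∈ Finset.range n, c i ^ 2)) * Real.exp (s * a))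
    (fun i => ?_) (fun i => by fun_prop) (fun i => BoundedOnBalls.of_continuous (by fun_prop)) ?_ n
  · rw [integral_const_mul, Real.exp_neg] at hV
    simp only [Finset.range_zero, Finset.sum_empty, mul_zero, Real.exp_zero, neg_zero, mul_one] at hV
    rwa [inv_mul_le_iff₀ (Real.exp_pos _), mul_one] at hV
  · have h1 : ConvexOn ℝ Set.univ fun a : ℝ => Real.exp (s * a) :=
      convexOn_exp.comp_linearMap (LinearMap.mul ℝ ℝ s)
    exact h1.smul (Real.exp_pos _).le
  · intro i a
    have h1 := Real.cosh_le_exp_half_sq (s * c i)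
    have e1 : Real.exp (s * (a + c i)) = Real.exp (s * a) * Real.exp (s * c i) := by
      rw [← Real.exp_add]; ring_nf
    have e2 : Real.exp (s * (a - c i)) = Real.exp (s * a) * Real.exp (-(s * c i)) := by
      rw [← Real.exp_add]; ring_nf
    have e3 : Real.exp (-(s ^ 2 / 2 * ∑ j ∈ Finset.range i, c j ^ 2)) =
        Real.exp (-(s ^ 2 / 2 * ∑ j ∈ Finset.range (i + 1), c j ^ 2)) *
          Real.exp ((s * c i) ^ 2 / 2) := by
      rw [← Real.exp_add, Finset.sum_range_succ]; ring_nf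
    rw [e1, e2, e3]
    rw [Real.cosh_eq] at h1
    have := mul_le_mul_of_nonneg_left h1
      (mul_pos (Real.exp_pos (-(s ^ 2 / 2 * ∑ j ∈ Finset.range (i + 1), c j ^ 2)))
        (Real.exp_pos (s * a))).le
    linarith

lemma toNNReal_remainder {F : Type*} [NormedAddCommGroup F] {x : ℕ → F}
    (hx : ∀ n, ∑ i ∈ Finset.range n, ‖x i‖ ^ 2 ≤ 1) (n : ℕ) :
    (1 - ∑ i ∈ Finset.range n, ‖x i‖ ^ 2).toNNReal =
      (1 - ∑ i ∈ Finset.range (n + 1), ‖x i‖ ^ 2).toNNReal + (‖x n‖ ^ 2).toNNReal := by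
  rw [← Real.toNNReal_add (sub_nonneg.2 (hx _)) (sq_nonneg _), Finset.sum_range_succ]
  ring_nf

/-- The potential smooths by a Gaussian carrying the variance not yet spent, starting from 1. What
remains after n steps is removed by Jensen (`cubePos_le_gaussCube`). -/
lemma integral_cubePos_le [IsProbabilityMeasure μ] (h : IsUnitMartingaleDiff μ 𝒢 ξ)
    {c : ℕ → ℝ} (hc : ∀ n, ∑ i ∈ Finset.range n, ‖c i‖ ^ 2 ≤ 1) (t : ℝ) (n : ℕ) :
    ∫ ω, cubePos ((∑ i ∈ Finset.range n, ξ i ω • c i) - t) ∂μ ≤ gaussCube 1 (-t) := by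
  have hcont : ∀ R, Continuous fun a => gaussCube R (a + -t) := fun R =>
    (continuous_gaussCube R).comp (by fun_prop)
  have hV := h.integral_potential_le c
    (V := fun n a => gaussCube (1 - ∑ i ∈ Finset.range n, ‖c i‖ ^ 2).toNNReal (a + -t))
    (fun i => by simpa [Function.comp_def] using (convexOn_gaussCube _).translate_left (-t))
    (fun i => hcont _)
    (fun i => BoundedOnBalls.of_continuous (hcont _)) ?_ n
  · refine le_trans ?_ (hV.trans (le_of_eq (by simp)))
    simp only [← sub_eq_add_neg] at hcont ⊢
    have hcc := continuous_cubePos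
    refine integral_mono (h.integrable_comp_sum c n (G := fun a => cubePos (a - t)) (by fun_prop)
      (BoundedOnBalls.of_continuous (by fun_prop)))
      (h.integrable_comp_sum c n (G := fun a => gaussCube _ (a - t)) (hcont _)
      (BoundedOnBalls.of_continuous (hcont _))) fun ω => cubePos_le_gaussCube _ _
  · intro i a
    have := gaussCube_two_point_le (1 - ∑ i ∈ Finset.range (i + 1), ‖c i‖ ^ 2).toNNReal
      (R' := (‖c i‖ ^ 2).toNNReal) (c := c i)
      (by rw [Real.coe_toNNReal _ (sq_nonneg _), Real.norm_eq_abs, sq_abs]) (a + -t)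
    rw [toNNReal_remainder hc i, add_right_comm a, show a - c i + -t = a + -t - c i by ring]
    linarith

lemma integral_cubePos_norm_le [IsProbabilityMeasure μ] (h : IsUnitMartingaleDiff μ 𝒢 ξ)
    {x : ℕ → E} (hx : ∀ n, ∑ i ∈ Finset.range n, ‖x i‖ ^ 2 ≤ 1) (t : ℝ) (n : ℕ) :
    ∫ ω, cubePos (‖∑ i ∈ Finset.range n, ξ i ω • x i‖ - t) ∂μ ≤ 2 * gaussCube 1 (-t) := by
  have hb : ∀ R, BoundedOnBalls (radialCube (E := E) (-t) R) := fun R => by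
    have := continuous_gaussCube R
    exact BoundedOnBalls.comp_norm (f := fun y => gaussCube R (-t + y) + gaussCube R (-t - y))
      (by fun_prop)
  have hV := h.integral_potential_le x
    (V := fun n a => radialCube (-t) (1 - ∑ i ∈ Finset.range n, ‖x i‖ ^ 2).toNNReal a)
    (fun i => convexOn_radialCube _ _) (fun i => continuous_radialCube _ _) (fun i => hb _) ?_ n
  · refine le_trans ?_ (hV.trans (le_of_eq (by simp [radialCube, two_mul])))
    have hcc := continuous_cubePos
    refine integral_mono (h.integrable_comp_sum x n (G := fun a => cubePos (‖a‖ - t)) (by fun_prop)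
      (BoundedOnBalls.comp_norm (f := fun y => cubePos (y - t)) (by fun_prop)))
      (h.integrable_comp_sum x n (continuous_radialCube _ _) (hb _)) fun ω => ?_
    have h1 := cubePos_le_gaussCube (1 - ∑ i ∈ Finset.range n, ‖x i‖ ^ 2).toNNReal
      (-t + ‖∑ i ∈ Finset.range n, ξ i ω • x i‖)
    have h2 := gaussCube_nonneg (1 - ∑ i ∈ Finset.range n, ‖x i‖ ^ 2).toNNReal
      (-t - ‖∑ i ∈ Finset.range n, ξ i ω • x i‖)
    rw [neg_add_eq_sub] at h1
    simp only [radialCube, neg_add_eq_sub]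
    linarith
  · intro i a
    have := radialCube_two_point_le (-t) (1 - ∑ i ∈ Finset.range (i + 1), ‖x i‖ ^ 2).toNNReal
      (R' := (‖x i‖ ^ 2).toNNReal) (x := x i) (by simp) a
    rw [toNNReal_remainder hx i]
    linarith

lemma submartingale_norm_sq [IsProbabilityMeasure μ] (h : IsUnitMartingaleDiff μ 𝒢 ξ)
    (x : ℕ → E) :
    Submartingale (fun n ω => ‖∑ i ∈ Finset.range n, ξ i ω • x i‖ ^ 2) 𝒢 μ := by
  have hb : BoundedOnBalls fun a : E => ‖a‖ ^ 2 :=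
    BoundedOnBalls.comp_norm (f := fun y => y ^ 2) (by fun_prop)
  have hi := fun n => h.integrable_comp_sum x n (G := fun a : E => ‖a‖ ^ 2) (by fun_prop) hb
  have hm : ∀ n, StronglyMeasurable[𝒢 n] fun ω => ‖∑ i ∈ Finset.range n, ξ i ω • x i‖ ^ 2 :=
    fun n => (h.stronglyMeasurable_sum x n).norm.pow 2
  refine submartingale_nat hm hi fun n => ?_
  set S : Ω → E := fun ω => ∑ i ∈ Finset.range n, ξ i ω • x i
  set W : Ω → ℝ := fun ω => 2 * inner ℝ (S ω) (x n)
  have hWm : StronglyMeasurable[𝒢 n] W := by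
    have hc : Continuous fun a : E => 2 * inner ℝ a (x n) := by fun_prop
    exact hc.comp_stronglyMeasurable (h.stronglyMeasurable_sum x n)
  have hWb : ∃ M : ℝ, ∀ᵐ ω ∂μ, ‖W ω‖ ≤ M := by
    obtain ⟨C, hC⟩ := h.exists_bound_sum x n
    refine ⟨2 * (C * ‖x n‖), hC.mono fun ω hω => ?_⟩
    simp only [W, norm_mul, Real.norm_two]
    gcongr
    exact (norm_inner_le_norm _ _).trans (by gcongr)
  have hξm : AEStronglyMeasurable (ξ n) μ := ((h.measurable n).mono (𝒢.le _)).aestronglyMeasurable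
  have hξi : Integrable (ξ n) μ := Integrable.of_bound hξm 1 (h.bound n)
  have hWξ : Integrable (W * ξ n) μ := by
    obtain ⟨M, hM⟩ := hWb
    exact hξi.bdd_mul (hWm.mono (𝒢.le n)).aestronglyMeasurable hM
  have h0 := condExp_mul_eq_zero (𝒢.le n) hWm hWb hξi (h.condExp_eq n)
  have h1 := condExp_of_stronglyMeasurable (𝒢.le n) (hm n) (hi n)
  have hle : (fun ω => ‖S ω‖ ^ 2) + W * ξ n ≤ᵐ[μ]
      fun ω => ‖∑ i ∈ Finset.range (n + 1), ξ i ω • x i‖ ^ 2 := by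
    refine ae_of_all _ fun ω => ?_
    simp only [Finset.sum_range_succ, Pi.add_apply, Pi.mul_apply, W]
    rw [norm_add_sq_real, real_inner_smul_right]
    have : 0 ≤ ‖ξ n ω • x n‖ ^ 2 := sq_nonneg _
    simp only [S]
    linarith
  filter_upwards [condExp_mono (m := 𝒢 n) ((hi n).add hWξ) (hi (n + 1)) hle,
    condExp_add (m := 𝒢 n) (hi n) hWξ, h0] with ω e1 e2 e3
  refine le_trans (le_of_eq ?_) e1
  rw [e2, Pi.add_apply, e3, h1]
  simp

end IsUnitMartingaleDiff

/-! ### Tail bounds for finite sums -/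

section

variable {Ω : Type*} {mΩ : MeasurableSpace Ω} {μ : Measure Ω}

lemma measureReal_le_integral_div [IsFiniteMeasure μ] {f : Ω → ℝ} (hf : ∀ ω, 0 ≤ f ω)
    (hi : Integrable f μ) {s : Set Ω} {ε : ℝ} (hε : 0 < ε) (hs : ∀ ω ∈ s, ε ≤ f ω) :
    μ.real s ≤ (∫ ω, f ω ∂μ) / ε := by
  rw [le_div_iff₀ hε, mul_comm]
  refine le_trans ?_ (mul_meas_ge_le_integral_of_nonneg (ae_of_all _ hf) hi ε)
  have hsub : s ⊆ {ω | ε ≤ f ω} := hs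
  exact mul_le_mul_of_nonneg_left (measureReal_mono hsub (measure_ne_top _ _)) hε.le

lemma le_twoSidedBound {p x : ℝ} (hx : 0 < x) (h1 : p ≤ 1) (h2 : p ≤ 1 / x ^ 2)
    (h3 : p ≤ 2 * (Real.exp lam * normalTail x)) : p ≤ twoSidedBound x := by
  refine le_min h2 ?_
  rcases le_total (√lam) x with h | h
  · have hnn : 0 ≤ x - lam / x := by
      rw [sub_nonneg, div_le_iff₀ hx, ← sq]
      exact (Real.sqrt_le_left hx.le).1 h
    rw [normalTwoTail_eq hnn]
    linarith [exp_lam_mul_normalTail_le h]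
  · rw [normalTwoTail_of_nonpos]
    · exact h1
    · rw [sub_nonpos, le_div_iff₀ hx, ← sq]
      exact (Real.le_sqrt hx.le lam_pos.le).1 h

lemma le_oneSidedBound {p x : ℝ} (hx : 0 < x) (h1 : p ≤ 1 / (1 + x ^ 2))
    (h2 : p ≤ Real.exp (-x ^ 2 / 2)) (h3 : p ≤ Real.exp lam * normalTail x) :
    p ≤ oneSidedBound x := by
  refine le_min h2 ?_
  rcases le_total (√lam) x with h | h
  · exact h3.trans (exp_lam_mul_normalTail_le h)
  · exact h1.trans (inv_one_add_sq_le_normalTail hx h)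

namespace IsUnitMartingaleDiff

variable {𝒢 : Filtration ℕ mΩ} {ξ : ℕ → Ω → ℝ}

section Hilbert

variable {E : Type*} [NormedAddCommGroup E] [InnerProductSpace ℝ E]

lemma measureReal_norm_ge_le_inv_sq [IsProbabilityMeasure μ] (h : IsUnitMartingaleDiff μ 𝒢 ξ)
    {v : ℕ → E} (hv : ∀ n, ∑ i ∈ Finset.range n, ‖v i‖ ^ 2 ≤ 1) (n : ℕ) {x : ℝ} (hx : 0 < x) :
    μ.real {ω | x ≤ ‖∑ i ∈ Finset.range n, ξ i ω • v i‖} ≤ 1 / x ^ 2 := by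
  have hi := h.integrable_comp_sum v n (by fun_prop) (boundedOnBalls_norm_add_sq (0 : E))
  refine (measureReal_le_integral_div (fun ω => by positivity) hi (pow_pos hx 2)
    fun ω hω => ?_).trans ?_
  · have hω' : x ≤ ‖∑ i ∈ Finset.range n, ξ i ω • v i‖ := hω
    rw [add_zero]
    gcongr
  · gcongr
    have := h.integral_norm_add_sq_le v 0 n
    rw [norm_zero] at this
    linarith [hv n]

lemma measureReal_norm_ge_le_normalTail [IsProbabilityMeasure μ]
    (h : IsUnitMartingaleDiff μ 𝒢 ξ) {v : ℕ → E}
    (hv : ∀ n, ∑ i ∈ Finset.range n, ‖v i‖ ^ 2 ≤ 1) (n : ℕ) (x : ℝ) :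
    μ.real {ω | x ≤ ‖∑ i ∈ Finset.range n, ξ i ω • v i‖} ≤
      2 * (Real.exp lam * normalTail x) := by
  obtain ⟨t, ht, htx⟩ := exists_gaussCube_le x
  have hc := continuous_cubePos
  have hi := h.integrable_comp_sum v n (G := fun a => cubePos (‖a‖ - t)) (by fun_prop)
    (BoundedOnBalls.comp_norm (f := fun y => cubePos (y - t)) (by fun_prop))
  have hxt : 0 < (x - t) ^ 3 := pow_pos (sub_pos.2 ht) 3
  refine (measureReal_le_integral_div (fun ω => cubePos_nonneg _) hi hxt fun ω hω => ?_).trans ?_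
  · have hω' : x ≤ ‖∑ i ∈ Finset.range n, ξ i ω • v i‖ := hω
    have : 0 ≤ x - t := (sub_pos.2 ht).le
    unfold cubePos
    gcongr
    exact le_max_of_le_left (by linarith)
  · rw [div_le_iff₀ hxt, exp_lam]
    linarith [h.integral_cubePos_norm_le hv t n]

end Hilbert

lemma measureReal_ge_le_normalTail [IsProbabilityMeasure μ] (h : IsUnitMartingaleDiff μ 𝒢 ξ)
    {c : ℕ → ℝ} (hc : ∀ n, ∑ i ∈ Finset.range n, ‖c i‖ ^ 2 ≤ 1) (n : ℕ) (x : ℝ) :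
    μ.real {ω | x ≤ ∑ i ∈ Finset.range n, ξ i ω • c i} ≤ Real.exp lam * normalTail x := by
  obtain ⟨t, ht, htx⟩ := exists_gaussCube_le x
  have hcc := continuous_cubePos
  have hi := h.integrable_comp_sum c n (G := fun a => cubePos (a - t)) (by fun_prop)
    (BoundedOnBalls.of_continuous (by fun_prop))
  have hxt : 0 < (x - t) ^ 3 := pow_pos (sub_pos.2 ht) 3
  refine (measureReal_le_integral_div (fun ω => cubePos_nonneg _) hi hxt fun ω hω => ?_).trans ?_
  · have hω' : x ≤ ∑ i ∈ Finset.range n, ξ i ω • c i := hω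
    have : 0 ≤ x - t := (sub_pos.2 ht).le
    unfold cubePos
    gcongr
    exact le_max_of_le_left (by linarith)
  · rw [div_le_iff₀ hxt, exp_lam]
    linarith [h.integral_cubePos_le hc t n]

lemma measureReal_ge_le_exp [IsProbabilityMeasure μ] (h : IsUnitMartingaleDiff μ 𝒢 ξ)
    {c : ℕ → ℝ} (hc : ∀ n, ∑ i ∈ Finset.range n, ‖c i‖ ^ 2 ≤ 1) (n : ℕ) {x : ℝ} (hx : 0 < x) :
    μ.real {ω | x ≤ ∑ i ∈ Finset.range n, ξ i ω • c i} ≤ Real.exp (-x ^ 2 / 2) := by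
  have hi := h.integrable_comp_sum c n (G := fun a => Real.exp (x * a)) (by fun_prop)
    (BoundedOnBalls.of_continuous (by fun_prop))
  refine (measureReal_le_integral_div (fun ω => (Real.exp_pos _).le) hi (Real.exp_pos (x * x))
    fun ω hω => ?_).trans ?_
  · have hω' : x ≤ ∑ i ∈ Finset.range n, ξ i ω • c i := hω
    gcongr
  · rw [div_le_iff₀ (Real.exp_pos _), ← Real.exp_add]
    refine (h.integral_exp_le c x n).trans (Real.exp_le_exp.2 ?_)
    have h1 : ∑ i ∈ Finset.range n, c i ^ 2 ≤ 1 := by simpa using hc n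
    nlinarith [sq_nonneg x]

/-- Cantelli's inequality. -/
lemma measureReal_ge_le_cantelli [IsProbabilityMeasure μ] (h : IsUnitMartingaleDiff μ 𝒢 ξ)
    {c : ℕ → ℝ} (hc : ∀ n, ∑ i ∈ Finset.range n, ‖c i‖ ^ 2 ≤ 1) (n : ℕ) {x : ℝ} (hx : 0 < x) :
    μ.real {ω | x ≤ ∑ i ∈ Finset.range n, ξ i ω • c i} ≤ 1 / (1 + x ^ 2) := by
  -- The shift b = 1/x minimises (1 + b²) / (x + b)², with minimum 1 / (1 + x²).
  have hi := h.integrable_comp_sum c n (by fun_prop) (boundedOnBalls_norm_add_sq (1 / x))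
  have hp : 0 < (x + 1 / x) ^ 2 := by positivity
  refine (measureReal_le_integral_div (fun ω => sq_nonneg _) hi hp fun ω hω => ?_).trans ?_
  · have hω' : x ≤ ∑ i ∈ Finset.range n, ξ i ω • c i := hω
    gcongr
    exact (add_le_add_left hω' _).trans (le_abs_self _)
  · rw [div_le_iff₀ hp]
    refine ((h.integral_norm_add_sq_le c (1 / x) n).trans
      (add_le_add_right (hc n) _)).trans (le_of_eq ?_)
    rw [Real.norm_eq_abs, sq_abs]
    field_simp
    ring

end IsUnitMartingaleDiff

/-! ### Almost sure convergence and passage to the limit -/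

/-- A tail bound that is continuous in the level passes to almost sure limits. -/
lemma measureReal_norm_ge_le_of_tendsto [IsFiniteMeasure μ] {E : Type*} [NormedAddCommGroup E]
    {U : ℕ → Ω → E} {T : Ω → E} (hU : ∀ n, AEStronglyMeasurable (U n) μ)
    (hT : ∀ᵐ ω ∂μ, Tendsto (fun n => U n ω) atTop (𝓝 (T ω))) {B : ℝ → ℝ} {x : ℝ}
    (hB : ContinuousAt B x) (h : ∀ᶠ y in 𝓝[<] x, ∀ n, μ.real {ω | y ≤ ‖U n ω‖} ≤ B y) :
    μ.real {ω | x ≤ ‖T ω‖} ≤ B x := by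
  refine ge_of_tendsto (hB.tendsto.mono_left nhdsWithin_le_nhds : Tendsto B (𝓝[<] x) _) ?_
  filter_upwards [h, self_mem_nhdsWithin] with y hy hyx
  have hyx' : 0 < x - y := sub_pos.2 hyx
  have hlim := tendstoInMeasure_of_tendsto_ae hU hT
  rw [tendstoInMeasure_iff_measureReal_norm] at hlim
  have hl := (hlim (x - y) hyx').const_add (B y)
  rw [add_zero] at hl
  refine ge_of_tendsto' hl fun n => ?_
  refine le_trans ?_ (add_le_add_left (hy n) _)
  -- If ‖T‖ ≥ x, then either ‖U n‖ ≥ y or U n is at distance at least x - y from T; the second event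
  -- has vanishing probability.
  refine (measureReal_mono fun ω hω => ?_).trans (measureReal_union_le _ _)
  have hω' : x ≤ ‖T ω‖ := hω
  by_cases hc : y ≤ ‖U n ω‖
  · exact Or.inl hc
  · refine Or.inr (?_ : x - y ≤ ‖U n ω - T ω‖)
    have := norm_sub_norm_le (T ω) (U n ω)
    rw [norm_sub_rev] at this
    linarith

namespace IsUnitMartingaleDiff

variable {E : Type*} [NormedAddCommGroup E] [InnerProductSpace ℝ E]

/-- Kolmogorov's maximal inequality on the whole half-line. -/
lemma measure_exists_norm_sum_ge_le [IsProbabilityMeasure μ] {𝒢 : Filtration ℕ mΩ}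
    {ξ : ℕ → Ω → ℝ} (h : IsUnitMartingaleDiff μ 𝒢 ξ) {v : ℕ → E} {r : ℝ}
    (hv : ∀ n, ∑ i ∈ Finset.range n, ‖v i‖ ^ 2 ≤ r) (ε : ℝ≥0) :
    ε * μ {ω | ∃ k, (ε : ℝ) ≤ ‖∑ i ∈ Finset.range k, ξ i ω • v i‖ ^ 2} ≤ ENNReal.ofReal r := by
  set f : ℕ → Ω → ℝ := fun n ω => ‖∑ i ∈ Finset.range n, ξ i ω • v i‖ ^ 2
  set A : ℕ → Set Ω := fun n => {ω | ∃ k ≤ n, (ε : ℝ) ≤ f k ω}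
  have hA : {ω | ∃ k, (ε : ℝ) ≤ f k ω} = ⋃ n, A n := by
    ext ω
    simp only [A, Set.mem_iUnion, Set.mem_ofPred_eq]
    exact ⟨fun ⟨k, hk⟩ => ⟨k, k, le_rfl, hk⟩, fun ⟨_, k, _, hk⟩ => ⟨k, hk⟩⟩
  have hmono : Monotone A := fun n m hnm ω ⟨k, hk, hω⟩ => ⟨k, hk.trans hnm, hω⟩
  rw [hA, hmono.measure_iUnion, ENNReal.mul_iSup]
  refine iSup_le fun n => ?_
  have hmax := maximal_ineq (h.submartingale_norm_sq v) (fun n ω => sq_nonneg _) (ε := ε) n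
  have hset : A n = {ω | (ε : ℝ) ≤ (Finset.range (n + 1)).sup' Finset.nonempty_range_add_one
      fun k => f k ω} := by
    ext ω
    simp only [A, Set.mem_ofPred_eq, Finset.le_sup'_iff, Finset.mem_range, Nat.lt_succ_iff]
  rw [hset]
  refine hmax.trans (ENNReal.ofReal_le_ofReal ?_)
  have hi : Integrable (f n) μ := (h.submartingale_norm_sq v).integrable n
  refine (setIntegral_le_integral hi (ae_of_all _ fun ω => sq_nonneg _)).trans ?_
  have := h.integral_norm_add_sq_le v 0 n
  simp only [add_zero, norm_zero] at this
  simp only [f]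
  linarith [hv n]

/-- The maximal inequality for the sequence restarted at m bounds the probability of an oscillation
of fixed size by a multiple of the tail Σ ‖v i‖² over i ≥ m, which tends to 0. -/
lemma ae_cauchySeq_sum [IsProbabilityMeasure μ] {𝒢 : Filtration ℕ mΩ}
    {ξ : ℕ → Ω → ℝ} (h : IsUnitMartingaleDiff μ 𝒢 ξ) {v : ℕ → E}
    (hv : Summable fun i => ‖v i‖ ^ 2) :
    ∀ᵐ ω ∂μ, CauchySeq fun n => ∑ i ∈ Finset.range n, ξ i ω • v i := by
  set r : ℕ → ℝ := fun m => ∑' i, ‖v (m + i)‖ ^ 2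
  have hr : Tendsto (fun m => ENNReal.ofReal (r m)) atTop (𝓝 0) := by
    have := tendsto_sum_nat_add fun i => ‖v i‖ ^ 2
    simp only [add_comm _ _] at this
    simpa [r, add_comm] using ENNReal.tendsto_ofReal this
  have key : ∀ j : ℕ, ∀ᵐ ω ∂μ, ∃ m, ∀ k,
      ‖∑ i ∈ Finset.range k, ξ (m + i) ω • v (m + i)‖ ^ 2 < (1 / (j + 1) : ℝ) ^ 2 := by
    intro j
    set ε : ℝ≥0 := (1 / (j + 1)) ^ 2
    have hε : (ε : ℝ) = (1 / (j + 1) : ℝ) ^ 2 := by simp [ε]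
    have hε0 : (ε : ℝ≥0∞) ≠ 0 := by
      have : 0 < ε := by positivity
      exact_mod_cast this.ne'
    rw [ae_iff]
    set N : Set Ω := {ω | ¬ ∃ m, ∀ k,
      ‖∑ i ∈ Finset.range k, ξ (m + i) ω • v (m + i)‖ ^ 2 < (1 / (j + 1) : ℝ) ^ 2}
    have hN : ∀ m, ε * μ N ≤ ENNReal.ofReal (r m) := by
      intro m
      refine le_trans ?_ ((h.shift m).measure_exists_norm_sum_ge_le
        (v := fun i => v (m + i)) (r := r m) (fun n => ?_) ε)
      · gcongr
        intro ω hω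
        have hω' : ¬ ∃ m, ∀ k,
          ‖∑ i ∈ Finset.range k, ξ (m + i) ω • v (m + i)‖ ^ 2 < (1 / (j + 1) : ℝ) ^ 2 := hω
        push Not at hω'
        rw [← hε] at hω'
        exact hω' m
      · refine Summable.sum_le_tsum _ (fun i _ => sq_nonneg _) ?_
        simpa only [add_comm m] using (summable_nat_add_iff m).2 hv
    have h0 : ε * μ N ≤ 0 := ge_of_tendsto' hr hN
    simpa [hε0] using h0
  filter_upwards [ae_all_iff.2 key] with ω hω
  rw [Metric.cauchySeq_iff']
  intro δ hδ
  obtain ⟨j, hj⟩ := exists_nat_one_div_lt hδ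
  obtain ⟨m, hm⟩ := hω j
  refine ⟨m, fun n hn => ?_⟩
  obtain ⟨k, rfl⟩ := Nat.exists_eq_add_of_le hn
  rw [dist_eq_norm, Finset.sum_range_add, add_sub_cancel_left]
  exact (lt_of_pow_lt_pow_left₀ 2 (by positivity) (hm k)).trans hj

end IsUnitMartingaleDiff

/-! ### Reduction to martingale differences bounded by 1 -/

/-- The filtration whose `n`-th term is generated by the first `n` of a sequence of functions. -/
def pastFiltration (η : ℕ → Ω → ℝ) (hη : ∀ i, Measurable (η i)) : Filtration ℕ mΩ where
  seq n := ⨆ i ∈ Set.Iio n, MeasurableSpace.comap (η i) inferInstance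
  mono' _ _ h := biSup_mono fun _ hi => lt_of_lt_of_le hi h
  le' _ := iSup₂_le fun i _ => (hη i).comap_le

lemma isUnitMartingaleDiff_of_iIndepFun [IsProbabilityMeasure μ] {η : ℕ → Ω → ℝ}
    (hη : ∀ i, Measurable (η i)) (hind : iIndepFun η μ) (h0 : ∀ i, ∫ ω, η i ω ∂μ = 0)
    (hb : ∀ i, ∀ᵐ ω ∂μ, |η i ω| ≤ 1) :
    IsUnitMartingaleDiff μ (pastFiltration η hη) η where
  measurable i := by
    have h1 : MeasurableSpace.comap (η i) inferInstance ≤ pastFiltration η hη (i + 1) :=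
      le_iSup₂_of_le i (Set.mem_Iio.2 (Nat.lt_succ_self i)) le_rfl
    exact ((comap_measurable (η i)).mono h1 le_rfl).stronglyMeasurable
  condExp_eq i := by
    have hI := indep_iSup_of_disjoint (fun i => (hη i).comap_le) hind
      (S := {i}) (T := Set.Iio i) (by simp)
    simp only [Set.mem_singleton_iff, iSup_iSup_eq_left] at hI
    have := condExp_indep_eq (hη i).comap_le ((pastFiltration η hη).le i)
      (comap_measurable (η i)).stronglyMeasurable hI
    rw [h0 i] at this
    exact this
  bound := hb

/-- Each increment is divided by its essential supremum c i, which turns the martingale into a sum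
with scalar coefficients. -/
lemma exists_isUnitMartingaleDiff [IsProbabilityMeasure μ] {ℱ : Filtration ℕ mΩ}
    {S : ℕ → Ω → ℝ} (hS : Martingale S ℱ μ) (h0 : ∀ᵐ ω ∂μ, S 0 ω = 0)
    (hsum : ∑' i : ℕ, essSup (fun ω => ‖S (i + 1) ω - S i ω‖ₑ ^ 2) μ ≤ 1) :
    ∃ (ξ : ℕ → Ω → ℝ) (c : ℕ → ℝ), IsUnitMartingaleDiff μ ℱ ξ ∧
      (∀ n, ∑ i ∈ Finset.range n, ‖c i‖ ^ 2 ≤ 1) ∧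
      ∀ n, ∀ᵐ ω ∂μ, S n ω = ∑ i ∈ Finset.range n, ξ i ω • c i := by
  set e : ℕ → ℝ≥0∞ := fun i => essSup (fun ω => ‖S (i + 1) ω - S i ω‖ₑ ^ 2) μ
  have he : ∀ i, e i ≠ ∞ := fun i =>
    ((ENNReal.le_tsum i).trans hsum).trans_lt ENNReal.one_lt_top |>.ne
  set c : ℕ → ℝ := fun i => √(e i).toReal
  have hX : ∀ i, ∀ᵐ ω ∂μ, |S (i + 1) ω - S i ω| ≤ c i := by
    intro i
    filter_upwards [ae_le_essSup (μ := μ) (f := fun ω => ‖S (i + 1) ω - S i ω‖ₑ ^ 2)] with ω hω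
    refine Real.le_sqrt_of_sq_le ?_
    have := ENNReal.toReal_mono (he i) hω
    simpa using this
  refine ⟨fun i ω => (c i)⁻¹ * (S (i + 1) ω - S i ω), c, ⟨fun i => ?_, fun i => ?_, fun i => ?_⟩,
    fun n => ?_, fun n => ?_⟩
  · exact ((hS.stronglyMeasurable (i + 1)).sub
      ((hS.stronglyMeasurable i).mono (ℱ.mono (Nat.le_succ i)))).const_mul _
  · have h1 := condExp_smul (μ := μ) (c i)⁻¹ (S (i + 1) - S i) (ℱ i)
    have h2 := condExp_sub (hS.integrable (i + 1)) (hS.integrable i) (ℱ i)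
    have h3 := hS.condExp_ae_eq (Nat.le_succ i)
    have h4 := hS.condExp_ae_eq (le_refl i)
    filter_upwards [h1, h2, h3, h4] with ω e1 e2 e3 e4
    refine e1.trans ?_
    rw [Pi.smul_apply, e2, Pi.sub_apply, e4]
    erw [e3]
    simp
  · filter_upwards [hX i] with ω hω
    rw [abs_mul, abs_inv, abs_of_nonneg (Real.sqrt_nonneg _ : 0 ≤ c i)]
    exact inv_mul_le_one_of_le₀ hω (Real.sqrt_nonneg _)
  · have h1 : ∑ i ∈ Finset.range n, ‖c i‖ ^ 2 = (∑ i ∈ Finset.range n, e i).toReal := by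
      rw [ENNReal.toReal_sum fun i _ => he i]
      refine Finset.sum_congr rfl fun i _ => ?_
      rw [Real.norm_of_nonneg (Real.sqrt_nonneg _), Real.sq_sqrt ENNReal.toReal_nonneg]
    rw [h1]
    have := ENNReal.toReal_mono ENNReal.one_ne_top ((ENNReal.sum_le_tsum (Finset.range n)).trans hsum)
    simpa using this
  · filter_upwards [h0, ae_all_iff.2 hX] with ω h0 hω
    have h1 : ∀ i, ((c i)⁻¹ * (S (i + 1) ω - S i ω)) • c i = S (i + 1) ω - S i ω := by
      intro i
      -- When c i = 0 the normalised increment is 0 by the convention 0⁻¹ = 0, and the original one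
      -- vanishes almost surely.
      by_cases hc : c i = 0
      · have := hω i
        rw [hc, abs_nonpos_iff] at this
        simp [this]
      · rw [smul_eq_mul]
        field_simp
    simp only [h1]
    rw [Finset.sum_range_sub (fun i => S i ω), h0, sub_zero]

end

end BoundedSums

theorem mainTheorem4 {Ω : Type*} [mΩ : MeasurableSpace Ω] (μ : Measure Ω) [IsProbabilityMeasure μ]
    {𝕜 : Type*} [RCLike 𝕜]
    {H : Type*} [NormedAddCommGroup H] [InnerProductSpace 𝕜 H] [CompleteSpace H] :
    (∀ (η : ℕ → Ω → ℝ) (v : ℕ → H),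
      (∀ i, Measurable (η i)) →
      iIndepFun η μ →
      (∀ i, ∫ ω, η i ω ∂μ = 0) →
      (∀ i, ∀ᵐ ω ∂μ, |η i ω| ≤ 1) →
      HasSum (fun i => ‖v i‖ ^ 2) 1 →
      (∀ᵐ ω ∂μ, ∃ s : H,
        Tendsto (fun n : ℕ => ∑ i ∈ Finset.range n, (η i ω : 𝕜) • v i) atTop (𝓝 s)) ∧
      ∀ T : Ω → H,
        (∀ᵐ ω ∂μ,
          Tendsto (fun n : ℕ => ∑ i ∈ Finset.range n, (η i ω : 𝕜) • v i) atTop (𝓝 (T ω))) →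
        ∀ x : ℝ, 0 < x → μ.real {ω | x ≤ ‖T ω‖} ≤ BoundedSums.twoSidedBound x) ∧
    (∀ (ℱ : Filtration ℕ mΩ) (S : ℕ → Ω → ℝ),
      Martingale S ℱ μ →
      (∀ᵐ ω ∂μ, S 0 ω = 0) →
      ∑' i : ℕ, essSup (fun ω => ‖S (i + 1) ω - S i ω‖ₑ ^ 2) μ ≤ 1 →
      ∀ (n : ℕ) (x : ℝ), 0 < x →
        μ.real {ω | x ≤ S n ω} ≤ BoundedSums.oneSidedBound x ∧
        μ.real {ω | x ≤ |S n ω|} ≤ BoundedSums.twoSidedBound x) := by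
  constructor
  · intro η v hη hind h0 hb hv
    -- The coefficients are real, so the real part of the inner product suffices and the complex
    -- case reduces to the real one.
    let _ : InnerProductSpace ℝ H := InnerProductSpace.rclikeToReal 𝕜 H
    have hsmul : ∀ (s : ℝ) (a : H), (s : 𝕜) • a = s • a := fun s a =>
      (RCLike.real_smul_eq_coe_smul (K := 𝕜) s a).symm
    simp only [hsmul]
    have hd := BoundedSums.isUnitMartingaleDiff_of_iIndepFun hη hind h0 hb
    have hv' : ∀ n, ∑ i ∈ Finset.range n, ‖v i‖ ^ 2 ≤ 1 := fun n =>
      sum_le_hasSum _ (fun i _ => sq_nonneg _) hv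
    refine ⟨?_, fun T hT x hx => ?_⟩
    · filter_upwards [hd.ae_cauchySeq_sum hv.summable] with ω hω
      exact cauchySeq_tendsto_of_complete hω
    · have hm := fun n => hd.aestronglyMeasurable_sum v n
      -- The limit is taken in each bound before they are combined, so only 1/y² and the normal tail
      -- need to be continuous.
      refine BoundedSums.le_twoSidedBound hx measureReal_le_one ?_ ?_
      · refine BoundedSums.measureReal_norm_ge_le_of_tendsto hm hT (B := fun y => 1 / y ^ 2)
          (continuousAt_const.div (by fun_prop) (by positivity)) ?_
        filter_upwards [nhdsWithin_le_nhds (eventually_gt_nhds hx)] with y hy n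
        exact hd.measureReal_norm_ge_le_inv_sq hv' n hy
      · have := BoundedSums.continuous_normalTail
        exact BoundedSums.measureReal_norm_ge_le_of_tendsto hm hT
          (B := fun y => 2 * (Real.exp BoundedSums.lam * BoundedSums.normalTail y))
          (by fun_prop) (Eventually.of_forall fun y n => hd.measureReal_norm_ge_le_normalTail hv' n y)
  · intro ℱ S hS h0 hsum n x hx
    obtain ⟨ξ, c, hd, hc, hSn⟩ := BoundedSums.exists_isUnitMartingaleDiff hS h0 hsum
    have e1 : μ.real {ω | x ≤ S n ω} = μ.real {ω | x ≤ ∑ i ∈ Finset.range n, ξ i ω • c i} := by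
      refine measureReal_congr ?_
      filter_upwards [hSn n] with ω hω
      exact congrArg (fun y => x ≤ y) hω
    have e2 : μ.real {ω | x ≤ |S n ω|} = μ.real {ω | x ≤ ‖∑ i ∈ Finset.range n, ξ i ω • c i‖} := by
      refine measureReal_congr ?_
      filter_upwards [hSn n] with ω hω
      exact congrArg (fun y => x ≤ |y|) hω
    rw [e1, e2]
    exact ⟨BoundedSums.le_oneSidedBound hx (hd.measureReal_ge_le_cantelli hc n hx)
      (hd.measureReal_ge_le_exp hc n hx) (hd.measureReal_ge_le_normalTail hc n x),
      BoundedSums.le_twoSidedBound hx measureReal_le_one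
      (hd.measureReal_norm_ge_le_inv_sq hc n hx) (hd.measureReal_norm_ge_le_normalTail hc n x)⟩
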